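/- Let $(V,\omega)$ be a real symplectic vector space of dimension $2n$. Let $\mathcal U(V)$ be the set of complex-valued alternating $n$-forms $\Omega\in\bigwedge^nV^*\otimes\mathbb C$ such that $\Omega\wedge\omega=0$ and $\Omega|_L\neq 0$ for every Lagrangian subspace $L\subset V$, and let $\mathcal U^+(V)$ be the connected component of $\mathcal U(V)$ which contains the nonzero forms of type $(n,0)$ with respect to some complex structure $J$ on $V$ compatible with $\omega$ (that is, $J^2=-1$, $\omega(Ju,Jv)=\omega(u,v)$, and $\omega(v,Jv)>0$ for $v\neq 0$). Write $\mathcal U^+(n)=\mathcal U^+(\mathbb C^n)$, where $\mathbb C^n$ has coordinates $z_j=x_j+iy_j$ and symplectic form $\sum_j dx_j\wedge dy_j$. The group $\mathrm{Sp}(2n,\mathbb R)\times\mathrm{GL}^+(2,\mathbb R)$ acts on complex-valued $n$-forms on $\mathbb C^n$: $\mathrm{Sp}(2n,\mathbb R)$ acts by linear changes of coordinates and $\mathrm{GL}^+(2,\mathbb R)$ acts on the values in $\mathbb C=\mathbb R^2$. Proposition. Every $\mathrm{Sp}(6,\mathbb R)\times\mathrm{GL}^+(2,\mathbb R)$-orbit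 in $\mathcal U^+(3)$ contains a $3$-form of the type \[ \Omega = dz_1\wedge dz_2\wedge dz_3+\gamma_1\,dz_1\wedge d\bar z_2\wedge d\bar z_3+\gamma_2\,d\bar z_1\wedge dz_2\wedge d\bar z_3+\gamma_3\,d\bar z_1\wedge d\bar z_2\wedge dz_3 \] with $\gamma_1,\gamma_2,\gamma_3\in\mathbb R$, $0\leq\gamma_1\leq\gamma_2\leq\gamma_3$ and $\gamma_1+\gamma_2+\gamma_3<1$. Conversely, every such form belongs to $\mathcal U^+(3)$. -/

import Mathlib

open scoped MatrixGroups

noncomputable section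

/-! ### Forms on a real normed space -/

section Forms

variable {V : Type*} [NormedAddCommGroup V] [NormedSpace ℝ V]

/-- The wedge product `f₁ ∧ ⋯ ∧ fₙ` of `𝕜`-valued (`𝕜 = ℝ` or `ℂ`) real-linear covectors:
`(f₁ ∧ ⋯ ∧ fₙ)(v₁, …, vₙ) = det (fᵢ(vⱼ))`. -/
def wedgeCovectors {𝕜 : Type*} [RCLike 𝕜] {n : ℕ} (f : Fin n → V →L[ℝ] 𝕜) :
    V [⋀^Fin n]→L[ℝ] 𝕜 where
  toFun v := Matrix.det (Matrix.of fun i j => f i (v j))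
  map_update_add' v j x y := by
    have h : ∀ z : V, (Matrix.of fun i k => f i (Function.update v j z k))
        = (Matrix.of fun i k => f i (v k)).updateCol j (fun i => f i z) := by
      intro z
      ext i k
      by_cases hk : k = j
      · subst hk; simp
      · simp [hk]
    have e : (fun a : DecidableEq (Fin n) => a) ‹_› = instDecidableEqFin n :=
      Subsingleton.elim _ _
    dsimp only at e
    subst e
    simp only [h, map_add]
    exact Matrix.det_updateCol_add _ j _ _
  map_update_smul' v j c x := by
    have h : ∀ z : V, (Matrix.of fun i k => f i (Function.update v j z k))
        = (Matrix.of fun i k => f i (v k)).updateCol j (fun i => f i z) := by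
      intro z
      ext i k
      by_cases hk : k = j
      · subst hk; simp
      · simp [hk]
    have e : (fun a : DecidableEq (Fin n) => a) ‹_› = instDecidableEqFin n :=
      Subsingleton.elim _ _
    dsimp only at e
    subst e
    have hc : (fun i => f i (c • x)) = (c : 𝕜) • (fun i => f i x) := by
      ext i
      simp [RCLike.real_smul_eq_coe_mul]
    rw [h, h, hc, Matrix.det_updateCol_smul, RCLike.real_smul_eq_coe_mul]
  map_eq_zero_of_eq' v i j hv hij :=
    Matrix.det_zero_of_column_eq hij fun k => by simp [hv]
  cont := by
    refine Continuous.matrix_det (continuous_matrix fun i j => ?_)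
    exact (f i).continuous.comp (continuous_apply j)

/-- The wedge product `α ∧ β` of a complex-valued form `α` with a real-valued form `β`. -/
def wedgeForms {ι κ : Type*} [Fintype ι] [Fintype κ] [DecidableEq ι] [DecidableEq κ]
    (α : V [⋀^ι]→L[ℝ] ℂ) (β : V [⋀^κ]→L[ℝ] ℝ) : V [⋀^ι ⊕ κ]→ₗ[ℝ] ℂ :=
  (TensorProduct.rid ℝ ℂ).toLinearMap.compAlternatingMap
    (α.toAlternatingMap.domCoprod β.toAlternatingMap)

/-- `L` is a Lagrangian subspace of `(V, ω)`: isotropic and of half the dimension of `V`. -/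
def IsLagrangianSubspace (ω : V [⋀^Fin 2]→L[ℝ] ℝ) (L : Submodule ℝ V) : Prop :=
  (∀ u ∈ L, ∀ v ∈ L, ω ![u, v] = 0) ∧ 2 * Module.finrank ℝ L = Module.finrank ℝ V

/-- `J` is a complex structure on `V` compatible with `ω`:
`J² = -1`, `ω(Ju, Jv) = ω(u, v)`, and `ω(v, Jv) > 0` for `v ≠ 0`. -/
def IsCompatibleComplexStructure (ω : V [⋀^Fin 2]→L[ℝ] ℝ) (J : V →L[ℝ] V) : Prop :=
  (∀ v, J (J v) = -v) ∧ (∀ u v, ω ![J u, J v] = ω ![u, v]) ∧ ∀ v, v ≠ 0 → 0 < ω ![v, J v]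

/-- The complex-valued `n`-form `Ω` is of type `(n, 0)` for the complex structure `J`, that is,
complex linear in every argument. -/
def IsTopHolomorphicType {n : ℕ} (J : V →L[ℝ] V) (Ω : V [⋀^Fin n]→L[ℝ] ℂ) : Prop :=
  ∀ (v : Fin n → V) (i : Fin n), Ω (Function.update v i (J (v i))) = Complex.I * Ω v

/-- `𝒰(V)` for a symplectic vector space `(V, ω)` of dimension `2n`: the complex-valued `n`-forms
`Ω` with `Ω ∧ ω = 0` whose restriction to every Lagrangian subspace is nonzero. -/
def formsU (n : ℕ) (ω : V [⋀^Fin 2]→L[ℝ] ℝ) : Set (V [⋀^Fin n]→L[ℝ] ℂ) :=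
  {Ω | wedgeForms Ω ω = 0 ∧
    ∀ L : Submodule ℝ V, IsLagrangianSubspace ω L →
      Ω.compContinuousLinearMap L.subtypeL ≠ 0}

/-- `𝒰⁺(V)`: the connected component of `𝒰(V)` which contains the (nonzero) forms of type `(n, 0)`
with respect to some compatible complex structure. -/
def formsUPlus (n : ℕ) (ω : V [⋀^Fin 2]→L[ℝ] ℝ) : Set (V [⋀^Fin n]→L[ℝ] ℂ) :=
  {Ω | ∃ J : V →L[ℝ] V, IsCompatibleComplexStructure ω J ∧
    ∃ Ω₀ ∈ formsU n ω, IsTopHolomorphicType J Ω₀ ∧ Ω ∈ connectedComponentIn (formsU n ω) Ω₀}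

/-- The symplectic group `Sp(V, ω)`. -/
def symplecticAut (ω : V [⋀^Fin 2]→L[ℝ] ℝ) : Subgroup (V ≃L[ℝ] V) where
  carrier := {g | ∀ u v, ω ![g u, g v] = ω ![u, v]}
  mul_mem' {a b} ha hb u v := by
    have h1 := ha (b u) (b v)
    have h2 := hb u v
    exact h1.trans h2
  one_mem' _ _ := rfl
  inv_mem' {a} ha u v := by
    have h := ha (a⁻¹ u) (a⁻¹ v)
    have hi : ∀ w, a (a⁻¹ w) = w := fun w => a.apply_symm_apply w
    rw [hi, hi] at h
    exact h.symm

/-- The linear action of a real `2 × 2` matrix on `ℂ = ℝ²`. -/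
def matrixOnComplex (A : Matrix (Fin 2) (Fin 2) ℝ) : ℂ →L[ℝ] ℂ :=
  LinearMap.toContinuousLinearMap (Matrix.toLin Complex.basisOneI Complex.basisOneI A)

/-- The action of `Sp(V, ω) × GL⁺(2, ℝ)` on complex-valued `n`-forms,
`(g, A) • Ω = A ∘ (g⁻¹)^*Ω`. -/
instance formsMulAction (n : ℕ) (ω : V [⋀^Fin 2]→L[ℝ] ℝ) :
    MulAction (symplecticAut ω × GL(2, ℝ)⁺) (V [⋀^Fin n]→L[ℝ] ℂ) where
  smul p Ω := (matrixOnComplex ((p.2 : GL (Fin 2) ℝ) : Matrix (Fin 2) (Fin 2) ℝ)).compContinuousAlternatingMap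
    (Ω.compContinuousLinearMap ((p.1⁻¹ : V ≃L[ℝ] V) : V →L[ℝ] V))
  one_smul Ω := by
    ext v
    change matrixOnComplex 1 (Ω fun i => v i) = Ω v
    simp [matrixOnComplex]
  mul_smul p q Ω := by
    ext v
    change matrixOnComplex
        (((p.2 : GL (Fin 2) ℝ) : Matrix (Fin 2) (Fin 2) ℝ) *
          ((q.2 : GL (Fin 2) ℝ) : Matrix (Fin 2) (Fin 2) ℝ))
        (Ω fun i => (((p.1 : V ≃L[ℝ] V) * (q.1 : V ≃L[ℝ] V))⁻¹) (v i)) =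
      matrixOnComplex ((p.2 : GL (Fin 2) ℝ) : Matrix (Fin 2) (Fin 2) ℝ)
        (matrixOnComplex ((q.2 : GL (Fin 2) ℝ) : Matrix (Fin 2) (Fin 2) ℝ)
          (Ω fun i => ((q.1 : V ≃L[ℝ] V)⁻¹) (((p.1 : V ≃L[ℝ] V)⁻¹) (v i))))
    rw [mul_inv_rev]
    simp only [matrixOnComplex, LinearMap.coe_toContinuousLinearMap',
      Matrix.toLin_mul Complex.basisOneI Complex.basisOneI Complex.basisOneI,
      LinearMap.comp_apply]
    rfl

end Forms

/-! ### The standard space `ℂⁿ` -/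

/-- The coordinate `dzⱼ` on `ℂⁿ`. -/
def dz {n : ℕ} (j : Fin n) : (Fin n → ℂ) →L[ℝ] ℂ := ContinuousLinearMap.proj j

/-- The conjugate coordinate `dz̄ⱼ` on `ℂⁿ`. -/
def dzbar {n : ℕ} (j : Fin n) : (Fin n → ℂ) →L[ℝ] ℂ :=
  (Complex.conjCLE : ℂ →L[ℝ] ℂ).comp (dz j)

/-- The real coordinate `dxⱼ` on `ℂⁿ`, where `zⱼ = xⱼ + i yⱼ`. -/
def dx {n : ℕ} (j : Fin n) : (Fin n → ℂ) →L[ℝ] ℝ := Complex.reCLM.comp (dz j)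

/-- The real coordinate `dyⱼ` on `ℂⁿ`, where `zⱼ = xⱼ + i yⱼ`. -/
def dy {n : ℕ} (j : Fin n) : (Fin n → ℂ) →L[ℝ] ℝ := Complex.imCLM.comp (dz j)

/-- The standard symplectic form `∑ⱼ dxⱼ ∧ dyⱼ` on `ℂⁿ`. -/
def stdSymplecticForm (n : ℕ) : (Fin n → ℂ) [⋀^Fin 2]→L[ℝ] ℝ :=
  ∑ j, wedgeCovectors ![dx j, dy j]

/-- The `3`-form `dz₁₂₃ + γ₁ dz_{1 2̄ 3̄} + γ₂ dz_{1̄ 2 3̄} + γ₃ dz_{1̄ 2̄ 3}` on `ℂ³`. -/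
def normalForm (γ₁ γ₂ γ₃ : ℝ) : (Fin 3 → ℂ) [⋀^Fin 3]→L[ℝ] ℂ :=
  wedgeCovectors ![dz 0, dz 1, dz 2]
    + γ₁ • wedgeCovectors ![dz 0, dzbar 1, dzbar 2]
    + γ₂ • wedgeCovectors ![dzbar 0, dz 1, dzbar 2]
    + γ₃ • wedgeCovectors ![dzbar 0, dzbar 1, dz 2]

end

/-!
Let `a` and `b` be the coefficients of `dz₁₂₃` and `dz̄₁₂₃` in `Ω`. The reduction to normal form
rests on minimizing the gap `|a|² - |b|²` over the symplectic orbit of `Ω`, where `Ω ∈ 𝒰⁺(ℂ³)`.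

*Domination.* On `𝒰⁺(ℂ³)` one has `|b| < |a|` (`norm_coeffB_lt_norm_coeffA`). The values of `Ω` on
the Lagrangian frames `c₁e₁, c₂e₂, c₃e₃` with `|cₖ| = 1` are, up to a unit factor, those of a
polynomial in `wₖ = c̄ₖ²` of degree one in each variable, with constant term `a` and leading
coefficient `b`. Fixing two of the vectors, `Ω` maps the line of the third one bijectively to `ℂ`;
this map preserves the orientation for forms of type `(3, 0)`, hence on the whole component
`𝒰⁺(ℂ³)`. Therefore the polynomial has no zero when a variable moves from the circle into the disc,
and a continuity argument extends this to the closed polydisc (`triaffine_ne_zero_of_formsUPlus`).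
Two Asano contractions then give `|b| < |a|`.

*Existence of a minimizer.* Small multiples of `dz₁₂₃` and of its conjugate can be added to `Ω`
inside `𝒰⁺(ℂ³)`. Domination for these perturbations bounds the gap of `g^*Ω` below by a multiple of
the gap of `g^*dz₁₂₃`, and the latter is a proper function on the symplectic group
(`opNorm_le_gap_holVol`). So the gap attains its minimum on the orbit (`exists_gap_minimizer`).

*Criticality.* A transformation `z ↦ z + μ z̄` of the values, with `|μ| < 1`, makes `b` zero and
multiplies the gap by a constant. Varying the minimizer along symplectic transvections shows that
the part of type `(2, 1)` vanishes (`coeffT_eq_zero_of_minimal`).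

*Diagonalization.* What remains is `a dz₁₂₃` plus a form of type `(1, 2)`, which amounts to a
symmetric matrix because `Ω ∧ ω = 0`. Unitary changes of coordinates act on it by unitary
congruence, and the Takagi factorization (`exists_takagi`) makes it diagonal with entries `0 ≤ γ₁ ≤
γ₂ ≤ γ₃`. The absence of zeros on the polydisc forces `γ₁ + γ₂ + γ₃ < 1`.

Conversely, on a unitary frame the normal form differs from `dz₁₂₃`, which has modulus one there,
by at most `γ₁ + γ₂ + γ₃` (`normalForm_mem_formsU`), so the segment from `dz₁₂₃` to it stays in
`𝒰(ℂ³)`.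
-/

noncomputable section

/-! ### The wedge product of a `3`-form and a `2`-form -/

section Wedge
variable {V : Type*} [NormedAddCommGroup V] [NormedSpace ℝ V]

theorem alternating_two_swap {F : Type*} [NormedAddCommGroup F] [NormedSpace ℝ F]
    (ω : V [⋀^Fin 2]→L[ℝ] F) (x y : V) : ω ![y, x] = -ω ![x, y] := by
  have := ω.toAlternatingMap.map_swap ![x, y] (i := 0) (j := 1) (by decide)
  rw [← ContinuousAlternatingMap.coe_toAlternatingMap, ← this]
  congr 1
  funext i; fin_cases i <;> rfl

theorem alternating_three_swap_left {F : Type*} [NormedAddCommGroup F] [NormedSpace ℝ F]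
    (Ω : V [⋀^Fin 3]→L[ℝ] F) (x y z : V) : Ω ![y, x, z] = -Ω ![x, y, z] := by
  have := Ω.toAlternatingMap.map_swap ![x, y, z] (i := 0) (j := 1) (by decide)
  rw [← ContinuousAlternatingMap.coe_toAlternatingMap, ← this]
  congr 1
  funext i; fin_cases i <;> rfl

theorem alternating_three_swap_right {F : Type*} [NormedAddCommGroup F] [NormedSpace ℝ F]
    (Ω : V [⋀^Fin 3]→L[ℝ] F) (x y z : V) : Ω ![x, z, y] = -Ω ![x, y, z] := by
  have := Ω.toAlternatingMap.map_swap ![x, y, z] (i := 1) (j := 2) (by decide)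
  rw [← ContinuousAlternatingMap.coe_toAlternatingMap, ← this]
  congr 1
  funext i; fin_cases i <;> rfl

/-- Up to the factor `12`, the wedge product of a `3`-form and a `2`-form is the signed sum over
all permutations of the five arguments. -/
theorem twelve_mul_wedgeForms (Ω : V [⋀^Fin 3]→L[ℝ] ℂ) (ω : V [⋀^Fin 2]→L[ℝ] ℝ)
    (v : Fin 3 ⊕ Fin 2 → V) :
    (12 : ℂ) * wedgeForms Ω ω v = ∑ σ : Equiv.Perm (Fin 3 ⊕ Fin 2), (Equiv.Perm.sign σ : ℤ) •
      ((ω fun i => v (σ (Sum.inr i)) : ℂ) * Ω fun i => v (σ (Sum.inl i))) := by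
  have h := congrArg (fun f => TensorProduct.rid ℝ ℂ (f v))
    (MultilinearMap.domCoprod_alternization_eq Ω.toAlternatingMap ω.toAlternatingMap)
  simp only [MultilinearMap.alternatization_apply, map_sum] at h
  have h2 : (12 : ℂ) * wedgeForms Ω ω v = TensorProduct.rid ℝ ℂ
      ((((Fintype.card (Fin 3)).factorial * (Fintype.card (Fin 2)).factorial) •
        Ω.toAlternatingMap.domCoprod ω.toAlternatingMap) v) := by
    have : (Fintype.card (Fin 3)).factorial * (Fintype.card (Fin 2)).factorial = 12 := by
      simp [Nat.factorial]
    rw [this]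
    generalize hN : (12 : ℕ) = N
    have hw : wedgeForms Ω ω v = TensorProduct.rid ℝ ℂ
      (Ω.toAlternatingMap.domCoprod ω.toAlternatingMap v) := by
      rw [wedgeForms, LinearMap.compAlternatingMap_apply, LinearEquiv.coe_toLinearMap]
    have hN' : (12 : ℂ) = (N : ℂ) := by rw [← hN]; norm_num
    rw [hN', AlternatingMap.smul_apply, map_nsmul, nsmul_eq_mul, hw]
  rw [h2, ← h]
  refine Finset.sum_congr rfl fun σ _ => ?_
  rw [MultilinearMap.domDomCongr_apply, MultilinearMap.domCoprod_apply]
  rw [Units.smul_def, map_zsmul]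
  simp [TensorProduct.rid_tmul]

/-- Explicit form of the vanishing of `Ω ∧ ω` for a `3`-form and a `2`-form: the sum over the ten
ways of choosing the two arguments of `ω`. -/
theorem wedgeForms_eq_zero_iff (Ω : V [⋀^Fin 3]→L[ℝ] ℂ) (ω : V [⋀^Fin 2]→L[ℝ] ℝ) :
    wedgeForms Ω ω = 0 ↔ ∀ a b c d e : V,
      ω ![a, b] * Ω ![c, d, e] - ω ![a, c] * Ω ![b, d, e] + ω ![a, d] * Ω ![b, c, e]
        - ω ![a, e] * Ω ![b, c, d] + ω ![b, c] * Ω ![a, d, e] - ω ![b, d] * Ω ![a, c, e]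
        + ω ![b, e] * Ω ![a, c, d] + ω ![c, d] * Ω ![a, b, e] - ω ![c, e] * Ω ![a, b, d]
        + ω ![d, e] * Ω ![a, b, c] = 0 := by
  -- the arguments of `ω` are listed first
  let e₅ : Fin 3 ⊕ Fin 2 ≃ Fin 5 := (Equiv.sumComm _ _).trans finSumFinEquiv
  -- a permutation of `Fin 5` is determined by the images of `0` and `1`, which are the arguments of
  -- `ω`, and a permutation of the remaining three arguments, which `Ω` absorbs
  have key : ∀ u : Fin 5 → V, (12 : ℂ) * wedgeForms Ω ω (u ∘ e₅) =
      ∑ p : Fin 5, ∑ q : Fin 4, (if p = 0 then 1 else -1 : ℤ) • (if q = 0 then 1 else -1 : ℤ) •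
        (6 * ((ω ![u p, u (Equiv.swap 0 p q.succ)] : ℂ) *
          Ω ![u (Equiv.swap 0 p (Equiv.swap 0 q 1).succ),
            u (Equiv.swap 0 p (Equiv.swap 0 q 2).succ),
            u (Equiv.swap 0 p (Equiv.swap 0 q 3).succ)])) := by
    intro u
    rw [twelve_mul_wedgeForms, ← (Equiv.permCongr e₅).symm.sum_comp,
      ← Equiv.Perm.decomposeFin.symm.sum_comp, Fintype.sum_prod_type]
    refine Finset.sum_congr rfl fun p _ => ?_
    rw [← Equiv.Perm.decomposeFin.symm.sum_comp, Fintype.sum_prod_type]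
    refine Finset.sum_congr rfl fun q _ => ?_
    have hterm : ∀ ρ : Equiv.Perm (Fin 3),
        (Equiv.Perm.sign ((Equiv.permCongr e₅).symm
          (Equiv.Perm.decomposeFin.symm (p, Equiv.Perm.decomposeFin.symm (q, ρ)))) : ℤ) •
        ((ω fun i => (u ∘ e₅) ((Equiv.permCongr e₅).symm
          (Equiv.Perm.decomposeFin.symm (p, Equiv.Perm.decomposeFin.symm (q, ρ)))
            (Sum.inr i)) : ℂ) *
        Ω fun i => (u ∘ e₅) ((Equiv.permCongr e₅).symm
          (Equiv.Perm.decomposeFin.symm (p, Equiv.Perm.decomposeFin.symm (q, ρ)))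
            (Sum.inl i))) =
        (if p = 0 then 1 else -1 : ℤ) • (if q = 0 then 1 else -1 : ℤ) •
        ((ω ![u p, u (Equiv.swap 0 p q.succ)] : ℂ) *
          Ω ![u (Equiv.swap 0 p (Equiv.swap 0 q 1).succ),
            u (Equiv.swap 0 p (Equiv.swap 0 q 2).succ),
            u (Equiv.swap 0 p (Equiv.swap 0 q 3).succ)]) := by
      intro ρ
      have h1 : (fun i => (u ∘ e₅) ((Equiv.permCongr e₅).symm
          (Equiv.Perm.decomposeFin.symm (p, Equiv.Perm.decomposeFin.symm (q, ρ)))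
            (Sum.inr i))) = ![u p, u (Equiv.swap 0 p q.succ)] := by
        have e0 : e₅ (Sum.inr 0) = 0 := rfl
        have e1 : e₅ (Sum.inr 1) = 1 := rfl
        funext i
        fin_cases i
        · simp [e0]
        · simp [e1, Equiv.Perm.decomposeFin_symm_apply_one]
      have h2 : (fun i => (u ∘ e₅) ((Equiv.permCongr e₅).symm
          (Equiv.Perm.decomposeFin.symm (p, Equiv.Perm.decomposeFin.symm (q, ρ)))
            (Sum.inl i))) = ![u (Equiv.swap 0 p (Equiv.swap 0 q 1).succ),
            u (Equiv.swap 0 p (Equiv.swap 0 q 2).succ),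
            u (Equiv.swap 0 p (Equiv.swap 0 q 3).succ)] ∘ ρ := by
        have e0 : ∀ i, e₅ (Sum.inl i) = i.succ.succ := by decide
        have e1 : ∀ k, u (Equiv.swap 0 p (Equiv.swap 0 q (Fin.succ k)).succ) =
            ![u (Equiv.swap 0 p (Equiv.swap 0 q 1).succ),
            u (Equiv.swap 0 p (Equiv.swap 0 q 2).succ),
            u (Equiv.swap 0 p (Equiv.swap 0 q 3).succ)] k := by
          intro k
          fin_cases k <;> rfl
        funext i
        simp only [Function.comp_apply, Equiv.permCongr_symm_apply, e0, Equiv.apply_symm_apply,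
          Equiv.Perm.decomposeFin_symm_apply_succ, e1]
      rw [h1, h2]
      have h3 := Ω.toAlternatingMap.map_perm ![u (Equiv.swap 0 p (Equiv.swap 0 q 1).succ),
            u (Equiv.swap 0 p (Equiv.swap 0 q 2).succ),
            u (Equiv.swap 0 p (Equiv.swap 0 q 3).succ)] ρ
      simp only [ContinuousAlternatingMap.coe_toAlternatingMap] at h3
      rw [h3, Equiv.permCongr_symm, Equiv.Perm.sign_permCongr, Equiv.Perm.decomposeFin.symm_sign,
        Equiv.Perm.decomposeFin.symm_sign, Units.smul_def]
      have : ((Equiv.Perm.sign ρ : ℤ) : ℂ) * ((Equiv.Perm.sign ρ : ℤ) : ℂ) = 1 := by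
        exact_mod_cast Int.units_coe_mul_self _
      generalize (ω ![u p, u (Equiv.swap 0 p q.succ)] : ℂ) = x
      generalize Ω ![u (Equiv.swap 0 p (Equiv.swap 0 q 1).succ),
        u (Equiv.swap 0 p (Equiv.swap 0 q 2).succ),
        u (Equiv.swap 0 p (Equiv.swap 0 q 3).succ)] = y
      split_ifs <;> simp only [zsmul_eq_mul, Units.val_mul] <;> push_cast
      · linear_combination (x * y) * this
      · linear_combination -(x * y) * this
      · linear_combination -(x * y) * this
      · linear_combination (x * y) * this
    rw [Finset.sum_congr rfl fun ρ _ => hterm ρ, Finset.sum_const, Finset.card_univ,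
      Fintype.card_perm]
    have h6 : (Fintype.card (Fin 3)).factorial = 6 := by simp [Nat.factorial]
    rw [h6, nsmul_eq_mul]
    split_ifs <;> simp
  have key2 : ∀ a b c d e : V, wedgeForms Ω ω (![a, b, c, d, e] ∘ e₅) =
      ω ![a, b] * Ω ![c, d, e] - ω ![a, c] * Ω ![b, d, e] + ω ![a, d] * Ω ![b, c, e]
        - ω ![a, e] * Ω ![b, c, d] + ω ![b, c] * Ω ![a, d, e] - ω ![b, d] * Ω ![a, c, e]
        + ω ![b, e] * Ω ![a, c, d] + ω ![c, d] * Ω ![a, b, e] - ω ![c, e] * Ω ![a, b, d]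
        + ω ![d, e] * Ω ![a, b, c] := by
    intro a b c d e
    have h := key ![a, b, c, d, e]
    have hs : ∀ x y, Equiv.swap (0 : Fin 4) x y = if y = 0 then x else if y = x then 0 else y :=
      fun x y => Equiv.swap_apply_def _ _ _
    have hs' : ∀ x y, Equiv.swap (0 : Fin 5) x y = if y = 0 then x else if y = x then 0 else y :=
      fun x y => Equiv.swap_apply_def _ _ _
    have f1 : (3 : Fin 4).succ = 4 := rfl
    simp only [Fin.sum_univ_succ, Fin.sum_univ_zero] at h
    simp [hs, hs', Fin.ext_iff, f1] at h
    simp only [alternating_two_swap ω a, alternating_two_swap ω b c, alternating_two_swap ω b d,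
      alternating_two_swap ω b e, alternating_two_swap ω c d, alternating_two_swap ω c e,
      alternating_two_swap ω d e] at h
    rw [alternating_three_swap_left Ω b c e, alternating_three_swap_left Ω a c e,
      alternating_three_swap_left Ω a b e, alternating_three_swap_right Ω c b d,
      alternating_three_swap_left Ω b c d, alternating_three_swap_right Ω c a d,
      alternating_three_swap_left Ω a c d, alternating_three_swap_right Ω a b d,
      alternating_three_swap_right Ω b a d, alternating_three_swap_left Ω a b d,
      alternating_three_swap_left Ω b c a, alternating_three_swap_left Ω a c b,
      alternating_three_swap_right Ω b a c, alternating_three_swap_right Ω a b c,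
      alternating_three_swap_left Ω a b c] at h
    push_cast at h
    linear_combination h / 12
  refine ⟨fun h a b c d e => by rw [← key2, h]; rfl, fun h => ?_⟩
  ext v
  have : v = ![v (.inr 0), v (.inr 1), v (.inl 0), v (.inl 1), v (.inl 2)] ∘ e₅ := by
    funext i
    rcases i with i | i <;> fin_cases i <;> rfl
  rw [this, key2, h]
  rfl

end Wedge

/-! ### Decomposition of `3`-forms on `ℂ³` by type -/

section Dolbeault
open Complex

theorem wedgeCovectors_apply {V : Type*} [NormedAddCommGroup V] [NormedSpace ℝ V]
    {𝕜 : Type*} [RCLike 𝕜] {n : ℕ} (f : Fin n → V →L[ℝ] 𝕜) (v : Fin n → V) :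
    wedgeCovectors f v = Matrix.det (Matrix.of fun i j => f i (v j)) := rfl

theorem wedgeCovectors_three_apply {V : Type*} [NormedAddCommGroup V] [NormedSpace ℝ V]
    {𝕜 : Type*} [RCLike 𝕜] (f g h : V →L[ℝ] 𝕜) (u v w : V) :
    wedgeCovectors ![f, g, h] ![u, v, w] =
      f u * (g v * h w - g w * h v) - f v * (g u * h w - g w * h u)
        + f w * (g u * h v - g v * h u) := by
  rw [wedgeCovectors_apply, Matrix.det_fin_three]
  simp
  ring

theorem stdSymplecticForm_apply (u v : Fin 3 → ℂ) :
    stdSymplecticForm 3 ![u, v] = ∑ j, ((u j).re * (v j).im - (u j).im * (v j).re) := by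
  simp only [stdSymplecticForm, ContinuousAlternatingMap.sum_apply]
  refine Finset.sum_congr rfl fun j _ => ?_
  rw [wedgeCovectors_apply, Matrix.det_fin_two]
  simp [dx, dy, dz]
  ring

/-- The real basis `∂/∂x₁, ∂/∂y₁, ∂/∂x₂, …` of `ℂ³`. -/
def realBasis : Module.Basis (Fin 6) ℝ (Fin 3 → ℂ) :=
  Module.Basis.ofEquivFun
    { toFun := fun u => ![(u 0).re, (u 0).im, (u 1).re, (u 1).im, (u 2).re, (u 2).im]
      invFun := fun x => ![⟨x 0, x 1⟩, ⟨x 2, x 3⟩, ⟨x 4, x 5⟩]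
      map_add' := fun u v => by ext i; fin_cases i <;> simp
      map_smul' := fun c u => by ext i; fin_cases i <;> simp
      left_inv := fun u => by ext i; fin_cases i <;> simp
      right_inv := fun u => by ext i; fin_cases i <;> simp }

theorem realBasis_apply : ⇑realBasis = ![Pi.single 0 1, Pi.single 0 I, Pi.single 1 1,
    Pi.single 1 I, Pi.single 2 1, Pi.single 2 I] := by
  funext i
  apply realBasis.equivFun.injective
  rw [Module.Basis.equivFun_apply, Module.Basis.repr_self]
  funext k
  fin_cases i <;> fin_cases k <;> simp [realBasis]

/-- Alternating maps agree if they agree on the increasing tuples of basis vectors. -/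
theorem AlternatingMap.ext_of_strictMono {R M N ι : Type*} [CommRing R] [AddCommGroup M]
    [Module R M] [AddCommGroup N] [Module R N] [LinearOrder ι] {n : ℕ}
    (b : Module.Basis ι R M) {f g : M [⋀^Fin n]→ₗ[R] N}
    (h : ∀ v : Fin n → ι, StrictMono v → f (b ∘ v) = g (b ∘ v)) : f = g := by
  refine b.ext_alternating fun v hv => ?_
  have hs : StrictMono (v ∘ Tuple.sort v) :=
    (Tuple.monotone_sort v).strictMono_of_injective (hv.comp (Tuple.sort v).injective)
  have h1 := h _ hs
  rw [← Function.comp_assoc, f.map_perm, g.map_perm] at h1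
  exact smul_left_cancel _ h1

/-- The `3`-form `a dz₁₂₃ + b dz̄₁₂₃ + ∑ Sⱼₘ dzⱼ ∧ dz̄ₘ₊₁ ∧ dz̄ₘ₊₂ + ∑ Tⱼₘ dz̄ⱼ ∧ dzₘ₊₁ ∧ dzₘ₊₂`
on `ℂ³`, indices being read modulo `3`. -/
def dolbeaultForm (a b : ℂ) (S T : Matrix (Fin 3) (Fin 3) ℂ) :
    (Fin 3 → ℂ) [⋀^Fin 3]→L[ℝ] ℂ :=
  a • wedgeCovectors ![dz 0, dz 1, dz 2] + b • wedgeCovectors ![dzbar 0, dzbar 1, dzbar 2]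
    + ∑ j, ∑ m, S j m • wedgeCovectors ![dz j, dzbar (m + 1), dzbar (m + 2)]
    + ∑ j, ∑ m, T j m • wedgeCovectors ![dzbar j, dz (m + 1), dz (m + 2)]

/-- The component of `Ω` in the basis of covectors `dz`, `dz̄`: the `p`-th sign, `-I` for `dz` and
`I` for `dz̄`, selects the complex linear or antilinear part of `Ω` in the `p`-th argument. -/
def typeCoeff (Ω : (Fin 3 → ℂ) [⋀^Fin 3]→L[ℝ] ℂ) (r s t : ℂ) (j k l : Fin 3) : ℂ :=
  (Ω ![Pi.single j 1, Pi.single k 1, Pi.single l 1]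
    + r * Ω ![Pi.single j I, Pi.single k 1, Pi.single l 1]
    + s * Ω ![Pi.single j 1, Pi.single k I, Pi.single l 1]
    + t * Ω ![Pi.single j 1, Pi.single k 1, Pi.single l I]
    + r * s * Ω ![Pi.single j I, Pi.single k I, Pi.single l 1]
    + r * t * Ω ![Pi.single j I, Pi.single k 1, Pi.single l I]
    + s * t * Ω ![Pi.single j 1, Pi.single k I, Pi.single l I]
    + r * s * t * Ω ![Pi.single j I, Pi.single k I, Pi.single l I]) / 8

/-- The coefficient of `dz₁ ∧ dz₂ ∧ dz₃`. -/
def coeffA (Ω : (Fin 3 → ℂ) [⋀^Fin 3]→L[ℝ] ℂ) : ℂ := typeCoeff Ω (-I) (-I) (-I) 0 1 2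

/-- The coefficient of `dz̄₁ ∧ dz̄₂ ∧ dz̄₃`. -/
def coeffB (Ω : (Fin 3 → ℂ) [⋀^Fin 3]→L[ℝ] ℂ) : ℂ := typeCoeff Ω I I I 0 1 2

/-- The coefficients of the forms `dzⱼ ∧ dz̄ₘ₊₁ ∧ dz̄ₘ₊₂`. -/
def coeffS (Ω : (Fin 3 → ℂ) [⋀^Fin 3]→L[ℝ] ℂ) : Matrix (Fin 3) (Fin 3) ℂ :=
  Matrix.of fun j m => typeCoeff Ω (-I) I I j (m + 1) (m + 2)

/-- The coefficients of the forms `dz̄ⱼ ∧ dzₘ₊₁ ∧ dzₘ₊₂`. -/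
def coeffT (Ω : (Fin 3 → ℂ) [⋀^Fin 3]→L[ℝ] ℂ) : Matrix (Fin 3) (Fin 3) ℂ :=
  Matrix.of fun j m => typeCoeff Ω I (-I) (-I) j (m + 1) (m + 2)

set_option maxHeartbeats 1000000 in
/-- Every complex-valued `3`-form on `ℂ³` is the sum of its components of types `(3, 0)`, `(0, 3)`,
`(1, 2)` and `(2, 1)`. -/
theorem eq_dolbeaultForm (Ω : (Fin 3 → ℂ) [⋀^Fin 3]→L[ℝ] ℂ) :
    Ω = dolbeaultForm (coeffA Ω) (coeffB Ω) (coeffS Ω) (coeffT Ω) := by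
  apply ContinuousAlternatingMap.toAlternatingMap_injective
  refine AlternatingMap.ext_of_strictMono realBasis fun v hv => ?_
  have hv' : realBasis ∘ v = ![realBasis (v 0), realBasis (v 1), realBasis (v 2)] := by
    funext i; fin_cases i <;> rfl
  rw [hv']
  have h01 : v 0 < v 1 := hv (by decide)
  have h12 : v 1 < v 2 := hv (by decide)
  generalize v 0 = i at h01 ⊢
  generalize v 1 = j at h01 h12 ⊢
  generalize v 2 = k at h12 ⊢
  simp only [ContinuousAlternatingMap.coe_toAlternatingMap]
  -- conditional rewriting rules which bring the arguments of `Ω` into increasing order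
  have s1 : ∀ p q r : Fin 6, q < p → Ω ![realBasis p, realBasis q, realBasis r] =
      -Ω ![realBasis q, realBasis p, realBasis r] := fun p q r _ =>
    alternating_three_swap_left Ω _ _ _
  have s2 : ∀ p q r : Fin 6, r < q → Ω ![realBasis p, realBasis q, realBasis r] =
      -Ω ![realBasis p, realBasis r, realBasis q] := fun p q r _ =>
    alternating_three_swap_right Ω _ _ _
  have s3 : ∀ p r : Fin 6, Ω ![realBasis p, realBasis p, realBasis r] = 0 := fun p r =>
    Ω.map_eq_zero_of_eq _ (i := 0) (j := 1) rfl (by decide)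
  have s4 : ∀ p r : Fin 6, Ω ![realBasis p, realBasis r, realBasis r] = 0 := fun p r =>
    Ω.map_eq_zero_of_eq _ (i := 1) (j := 2) rfl (by decide)
  have b0 : (Pi.single 0 1 : Fin 3 → ℂ) = realBasis 0 := by rw [realBasis_apply]; rfl
  have b1 : (Pi.single 0 I : Fin 3 → ℂ) = realBasis 1 := by rw [realBasis_apply]; rfl
  have b2 : (Pi.single 1 1 : Fin 3 → ℂ) = realBasis 2 := by rw [realBasis_apply]; rfl
  have b3 : (Pi.single 1 I : Fin 3 → ℂ) = realBasis 3 := by rw [realBasis_apply]; rfl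
  have b4 : (Pi.single 2 1 : Fin 3 → ℂ) = realBasis 4 := by rw [realBasis_apply]; rfl
  have b5 : (Pi.single 2 I : Fin 3 → ℂ) = realBasis 5 := by rw [realBasis_apply]; rfl
  have hI : I ^ 2 = -1 := I_sq
  fin_cases i <;> fin_cases j <;> try (exact absurd h01 (by decide))
  all_goals fin_cases k <;> try (exact absurd h12 (by decide))
  all_goals
    simp (disch := decide) only [dolbeaultForm, ContinuousAlternatingMap.add_apply,
      ContinuousAlternatingMap.smul_apply, wedgeCovectors_three_apply, Fin.sum_univ_three,
      coeffA, coeffB, coeffS, coeffT, typeCoeff, Matrix.of_apply, Fin.isValue, Fin.reduceAdd,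
      Fin.zero_eta, Fin.mk_one, Fin.reduceFinMk, b0, b1, b2, b3, b4, b5, s1, s2, s3, s4]
    simp [dz, dzbar, realBasis_apply]
    ring_nf
    try simp only [hI]
    try ring

end Dolbeault

/-! ### Primitive forms and pull-back by transvections -/

section Coefficients
open Complex

theorem compContinuousLinearMap_three_apply {V W : Type*} [NormedAddCommGroup V] [NormedSpace ℝ V]
    [NormedAddCommGroup W] [NormedSpace ℝ W]
    (Ω : V [⋀^Fin 3]→L[ℝ] ℂ) (h : W →L[ℝ] V) (u v w : W) :
    Ω.compContinuousLinearMap h ![u, v, w] = Ω ![h u, h v, h w] := by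
  rw [ContinuousAlternatingMap.compContinuousLinearMap_apply]
  congr 1
  funext i; fin_cases i <;> rfl

/-- The complex conjugate of a form. -/
def conjForm (Ω : (Fin 3 → ℂ) [⋀^Fin 3]→L[ℝ] ℂ) : (Fin 3 → ℂ) [⋀^Fin 3]→L[ℝ] ℂ :=
  (Complex.conjCLE : ℂ →L[ℝ] ℂ).compContinuousAlternatingMap Ω

theorem conjForm_apply (Ω : (Fin 3 → ℂ) [⋀^Fin 3]→L[ℝ] ℂ) (v : Fin 3 → Fin 3 → ℂ) :
    conjForm Ω v = (starRingEnd ℂ) (Ω v) := rfl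

theorem coeffA_add_smul (Ω Ω' : (Fin 3 → ℂ) [⋀^Fin 3]→L[ℝ] ℂ) (c : ℂ) :
    coeffA (Ω + c • Ω') = coeffA Ω + c * coeffA Ω' := by
  simp only [coeffA, typeCoeff, ContinuousAlternatingMap.add_apply,
    ContinuousAlternatingMap.smul_apply, smul_eq_mul]
  ring

theorem coeffB_add_smul (Ω Ω' : (Fin 3 → ℂ) [⋀^Fin 3]→L[ℝ] ℂ) (c : ℂ) :
    coeffB (Ω + c • Ω') = coeffB Ω + c * coeffB Ω' := by
  simp only [coeffB, typeCoeff, ContinuousAlternatingMap.add_apply,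
    ContinuousAlternatingMap.smul_apply, smul_eq_mul]
  ring

theorem coeffA_conjForm (Ω : (Fin 3 → ℂ) [⋀^Fin 3]→L[ℝ] ℂ) :
    coeffA (conjForm Ω) = (starRingEnd ℂ) (coeffB Ω) := by
  simp [coeffA, coeffB, typeCoeff, conjForm_apply, map_ofNat]

theorem coeffB_conjForm (Ω : (Fin 3 → ℂ) [⋀^Fin 3]→L[ℝ] ℂ) :
    coeffB (conjForm Ω) = (starRingEnd ℂ) (coeffA Ω) := by
  simp [coeffA, coeffB, typeCoeff, conjForm_apply, map_ofNat]

/-- If `Ω ∧ ω = 0` then the contraction of `Ω` with the Poisson bivector vanishes; here it is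
evaluated on the vectors of the standard real basis. -/
theorem contraction_eq_zero {Ω : (Fin 3 → ℂ) [⋀^Fin 3]→L[ℝ] ℂ}
    (hΩ : wedgeForms Ω (stdSymplecticForm 3) = 0) (k : Fin 3) (z : ℂ) (hz : z = 1 ∨ z = I) :
    ∑ j, Ω ![Pi.single k z, Pi.single j 1, Pi.single j I] = 0 := by
  rw [wedgeForms_eq_zero_iff] at hΩ
  have h0 : Ω ![Pi.single k z, Pi.single k 1, Pi.single k I] = 0 := by
    rcases hz with rfl | rfl
    · exact Ω.map_eq_zero_of_eq _ (i := 0) (j := 1) rfl (by decide)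
    · exact Ω.map_eq_zero_of_eq _ (i := 0) (j := 2) rfl (by decide)
  have h := hΩ (Pi.single k z) (Pi.single (k + 1) 1) (Pi.single (k + 1) I) (Pi.single (k + 2) 1)
    (Pi.single (k + 2) I)
  simp only [stdSymplecticForm_apply, Fin.sum_univ_three] at h ⊢
  fin_cases k <;> simp at h h0 ⊢ <;> rw [h0] <;> linear_combination h

/-- The mixed components of a primitive form are given by symmetric matrices. -/
theorem coeff_isSymm_of_primitive {a b : ℂ} {S T : Matrix (Fin 3) (Fin 3) ℂ}
    (h : wedgeForms (dolbeaultForm a b S T) (stdSymplecticForm 3) = 0) :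
    S.IsSymm ∧ T.IsSymm := by
  have h1 := fun k => contraction_eq_zero h k 1 (Or.inl rfl)
  have hI := fun k => contraction_eq_zero h k I (Or.inr rfl)
  have a0 := h1 0
  have a1 := h1 1
  have a2 := h1 2
  have b0 := hI 0
  have b1 := hI 1
  have b2 := hI 2
  clear h1 hI h
  simp [Fin.sum_univ_three, dolbeaultForm, wedgeCovectors_three_apply, dz, dzbar]
    at a0 a1 a2 b0 b1 b2
  have e12 : S 1 2 = S 2 1 ∧ T 1 2 = T 2 1 :=
    ⟨by linear_combination b0 / 4 - I * a0 / 4 + (S 1 2 - T 1 2 - S 2 1 + T 2 1) / 2 * I_sq,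
     by linear_combination b0 / 4 + I * a0 / 4 - (S 1 2 - T 1 2 - S 2 1 + T 2 1) / 2 * I_sq⟩
  have e02 : S 0 2 = S 2 0 ∧ T 0 2 = T 2 0 :=
    ⟨by linear_combination -b1 / 4 + I * a1 / 4 + (S 0 2 - T 0 2 - S 2 0 + T 2 0) / 2 * I_sq,
     by linear_combination -b1 / 4 - I * a1 / 4 - (S 0 2 - T 0 2 - S 2 0 + T 2 0) / 2 * I_sq⟩
  have e01 : S 0 1 = S 1 0 ∧ T 0 1 = T 1 0 :=
    ⟨by linear_combination b2 / 4 - I * a2 / 4 + (S 0 1 - T 0 1 - S 1 0 + T 1 0) / 2 * I_sq,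
     by linear_combination b2 / 4 + I * a2 / 4 - (S 0 1 - T 0 1 - S 1 0 + T 1 0) / 2 * I_sq⟩
  constructor <;> ext i j <;> fin_cases i <;> fin_cases j <;>
    simp [e12.1, e12.2, e02.1, e02.2, e01.1, e01.2]

/-- The symplectic transvection `v ↦ v + s ω(u, v) u`. -/
def transvection (u : Fin 3 → ℂ) (s : ℝ) : (Fin 3 → ℂ) →L[ℝ] (Fin 3 → ℂ) :=
  ContinuousLinearMap.id ℝ _ + s • ContinuousLinearMap.smulRight
    (∑ j, ((u j).re • dy j - (u j).im • dx j)) u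

theorem transvection_apply (u v : Fin 3 → ℂ) (s : ℝ) :
    transvection u s v = v + (s * stdSymplecticForm 3 ![u, v]) • u := by
  simp [transvection, stdSymplecticForm_apply, mul_smul, dx, dy, dz]

theorem transvection_symplectic (u : Fin 3 → ℂ) (s : ℝ) (v w : Fin 3 → ℂ) :
    stdSymplecticForm 3 ![transvection u s v, transvection u s w] =
      stdSymplecticForm 3 ![v, w] := by
  simp only [transvection_apply]
  simp only [stdSymplecticForm_apply, Fin.sum_univ_three, Pi.add_apply, Pi.smul_apply,
    Complex.add_re, Complex.add_im, Complex.smul_re, Complex.smul_im, smul_eq_mul]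
  ring

theorem alternating_three_rotate {V : Type*} [NormedAddCommGroup V] [NormedSpace ℝ V]
    (Ω : V [⋀^Fin 3]→L[ℝ] ℂ) (x y z : V) : Ω ![x, y, z] = Ω ![y, z, x] := by
  rw [alternating_three_swap_right Ω y x z, alternating_three_swap_left Ω x y z, neg_neg]

theorem alternating_three_add_smul {V : Type*} [NormedAddCommGroup V] [NormedSpace ℝ V]
    (Ω : V [⋀^Fin 3]→L[ℝ] ℂ) (x u y z : V) (c : ℝ) :
    Ω ![x + c • u, y, z] = Ω ![x, y, z] + c * Ω ![u, y, z] := by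
  rw [ContinuousAlternatingMap.vecCons_add, ContinuousAlternatingMap.vecCons_smul,
    Complex.real_smul]

/-- Pull-back by a transvection is affine in the parameter, because an alternating form vanishes on
tuples containing `u` twice. -/
theorem comp_transvection_apply (Ω : (Fin 3 → ℂ) [⋀^Fin 3]→L[ℝ] ℂ)
    (u x y z : Fin 3 → ℂ) (s : ℝ) :
    Ω ![transvection u s x, transvection u s y, transvection u s z] =
      Ω ![x, y, z] + s * (stdSymplecticForm 3 ![u, x] * Ω ![u, y, z]
        + stdSymplecticForm 3 ![u, y] * Ω ![u, z, x]
        + stdSymplecticForm 3 ![u, z] * Ω ![u, x, y]) := by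
  have h1 : ∀ p, Ω ![u, u, p] = 0 := fun p =>
    Ω.map_eq_zero_of_eq _ (i := 0) (j := 1) rfl (by decide)
  have h2 : ∀ p, Ω ![u, p, u] = 0 := fun p =>
    Ω.map_eq_zero_of_eq _ (i := 0) (j := 2) rfl (by decide)
  have h3 : ∀ p, Ω ![p, u, u] = 0 := fun p =>
    Ω.map_eq_zero_of_eq _ (i := 1) (j := 2) rfl (by decide)
  simp only [transvection_apply]
  rw [alternating_three_add_smul, alternating_three_rotate Ω x, alternating_three_rotate Ω u]
  simp only [alternating_three_add_smul]
  rw [alternating_three_rotate Ω y, alternating_three_rotate Ω u _ x,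
    alternating_three_rotate Ω y, alternating_three_rotate Ω u _ u]
  simp only [alternating_three_add_smul, h1, h2, h3]
  rw [alternating_three_rotate Ω z x y, alternating_three_rotate Ω u x y,
    alternating_three_rotate Ω z u y, alternating_three_rotate Ω u z x]
  push_cast
  ring

/-- The first-order variation of the `(3, 0)`-coefficient along a transvection involves only the
`(3, 0)`- and the `(2, 1)`-parts of the form. -/
theorem coeffA_comp_transvection (a b : ℂ) (S T : Matrix (Fin 3) (Fin 3) ℂ) (u : Fin 3 → ℂ)
    (s : ℝ) :
    coeffA ((dolbeaultForm a b S T).compContinuousLinearMap (transvection u s)) =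
      coeffA (dolbeaultForm a b S T) - s * (I / 2 * (a * ∑ j, (starRingEnd ℂ) (u j) * u j
        + ∑ j, ∑ m, (starRingEnd ℂ) (u j) * T j m * (starRingEnd ℂ) (u m))) := by
  -- the part of type `(2, 0)` of the contraction of the form with `v`
  have hP : ∀ (v : Fin 3 → ℂ) (k l m : Fin 3), ((k, l, m) = (1, 2, 0) ∨ (k, l, m) = (2, 0, 1) ∨
      (k, l, m) = (0, 1, 2)) →
      dolbeaultForm a b S T ![v, Pi.single k 1, Pi.single l 1]
      - I * dolbeaultForm a b S T ![v, Pi.single k I, Pi.single l 1]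
      - I * dolbeaultForm a b S T ![v, Pi.single k 1, Pi.single l I]
      - dolbeaultForm a b S T ![v, Pi.single k I, Pi.single l I] =
      4 * (a * v m + ∑ j, (starRingEnd ℂ) (v j) * T j m) := by
    intro v k l m hklm
    rcases hklm with h | h | h <;> obtain ⟨rfl, rfl, rfl⟩ := by simpa using h
    all_goals
      simp [dolbeaultForm, Fin.sum_univ_three, wedgeCovectors_three_apply, dz, dzbar]
      ring_nf
      simp only [I_sq]
      try ring
  have h0 := hP u 1 2 0 (by simp)
  have h1 := hP u 2 0 1 (by simp)
  have h2 := hP u 0 1 2 (by simp)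
  clear hP
  have hκ : ∀ j, -((u j).im : ℂ) - I * (u j).re = -I * (starRingEnd ℂ) (u j) := by
    intro j
    apply Complex.ext <;> simp
  generalize dolbeaultForm a b S T = Ω at h0 h1 h2 ⊢
  simp only [coeffA, typeCoeff, compContinuousLinearMap_three_apply, comp_transvection_apply]
  have hω1 : ∀ j, stdSymplecticForm 3 ![u, Pi.single j 1] = -(u j).im := by
    intro j
    simp only [stdSymplecticForm_apply, Fin.sum_univ_three]
    fin_cases j <;> simp
  have hωI : ∀ j, stdSymplecticForm 3 ![u, Pi.single j I] = (u j).re := by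
    intro j
    simp only [stdSymplecticForm_apply, Fin.sum_univ_three]
    fin_cases j <;> simp
  simp only [hω1, hωI, Fin.sum_univ_three] at h0 h1 h2 ⊢
  have k0 := hκ 0
  have k1 := hκ 1
  have k2 := hκ 2
  push_cast
  linear_combination
    (s / 8 * (Ω ![u, Pi.single 1 1, Pi.single 2 1] - I * Ω ![u, Pi.single 1 I, Pi.single 2 1]
      - I * Ω ![u, Pi.single 1 1, Pi.single 2 I] - Ω ![u, Pi.single 1 I, Pi.single 2 I])) * k0
    + (s / 8 * (Ω ![u, Pi.single 2 1, Pi.single 0 1] - I * Ω ![u, Pi.single 2 I, Pi.single 0 1]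
      - I * Ω ![u, Pi.single 2 1, Pi.single 0 I] - Ω ![u, Pi.single 2 I, Pi.single 0 I])) * k1
    + (s / 8 * (Ω ![u, Pi.single 0 1, Pi.single 1 1] - I * Ω ![u, Pi.single 0 I, Pi.single 1 1]
      - I * Ω ![u, Pi.single 0 1, Pi.single 1 I] - Ω ![u, Pi.single 0 I, Pi.single 1 I])) * k2
    + (s / 8 * (-I * (starRingEnd ℂ) (u 0))) * h0
    + (s / 8 * (-I * (starRingEnd ℂ) (u 1))) * h1
    + (s / 8 * (-I * (starRingEnd ℂ) (u 2))) * h2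
    - s / 8 * ((((u 0).im : ℂ) + I * (u 0).re) * Ω ![u, Pi.single 1 I, Pi.single 2 I]
      + (((u 1).im : ℂ) + I * (u 1).re) * Ω ![u, Pi.single 2 I, Pi.single 0 I]
      + (((u 2).im : ℂ) + I * (u 2).re) * Ω ![u, Pi.single 0 I, Pi.single 1 I]) * I_sq

/-- Pull-back by a transvection changes the `(0, 3)`-coefficient by a multiple of the parameter. -/
theorem coeffB_comp_transvection (Ω : (Fin 3 → ℂ) [⋀^Fin 3]→L[ℝ] ℂ) (u : Fin 3 → ℂ) :
    ∃ β : ℂ, ∀ s : ℝ, coeffB (Ω.compContinuousLinearMap (transvection u s)) =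
      coeffB Ω + s * β := by
  refine ⟨coeffB (Ω.compContinuousLinearMap (transvection u 1)) - coeffB Ω, fun s => ?_⟩
  simp only [coeffB, typeCoeff, compContinuousLinearMap_three_apply, comp_transvection_apply]
  push_cast
  ring

end Coefficients

/-! ### Lagrangian subspaces and unitary matrices -/

section Lagrangian
open Complex

theorem stdSymplecticForm_eq_im (u v : Fin 3 → ℂ) :
    stdSymplecticForm 3 ![u, v] = (v ⬝ᵥ star u).im := by
  rw [stdSymplecticForm_apply, dotProduct, Complex.im_sum]
  refine Finset.sum_congr rfl fun j _ => ?_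
  simp
  ring

/-- A Lagrangian subspace of `ℂ³` has a real basis consisting of the rows of a unitary matrix: an
orthonormal basis for the real inner product is unitary because the imaginary part of the hermitian
product is the symplectic form. -/
theorem exists_unitary_of_lagrangian {L : Submodule ℝ (Fin 3 → ℂ)}
    (hL : IsLagrangianSubspace (stdSymplecticForm 3) L) :
    ∃ U ∈ Matrix.unitaryGroup (Fin 3) ℂ, ∃ b : Module.Basis (Fin 3) ℝ L,
      ∀ j, (b j : Fin 3 → ℂ) = U j := by
  let e : EuclideanSpace ℂ (Fin 3) ≃ₗ[ℝ] (Fin 3 → ℂ) := WithLp.linearEquiv 2 ℝ (Fin 3 → ℂ)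
  let L' : Submodule ℝ (EuclideanSpace ℂ (Fin 3)) := L.comap (e : _ →ₗ[ℝ] _)
  let eL : L' ≃ₗ[ℝ] L := LinearEquiv.ofSubmodule' e L
  have hdim : Module.finrank ℝ (Fin 3 → ℂ) = 6 := by
    rw [Module.finrank_eq_card_basis realBasis, Fintype.card_fin]
  have hfin : Module.finrank ℝ L' = 3 := by
    rw [eL.finrank_eq]
    have := hL.2
    omega
  let b' : OrthonormalBasis (Fin 3) ℝ L' :=
    (stdOrthonormalBasis ℝ L').reindex (finCongr hfin)
  refine ⟨Matrix.of fun j => e (b' j), ?_, b'.toBasis.map eL, fun j => ?_⟩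
  · rw [Matrix.mem_unitaryGroup_iff]
    ext j k
    rw [Matrix.mul_apply]
    have him : stdSymplecticForm 3 ![e (b' k), e (b' j)] = 0 :=
      hL.1 _ (b' k).2 _ (b' j).2
    have hre : inner ℝ (b' k) (b' j) = if k = j then (1 : ℝ) else 0 :=
      orthonormal_iff_ite.mp b'.orthonormal k j
    rw [Submodule.coe_inner, PiLp.inner_apply] at hre
    rw [stdSymplecticForm_eq_im, dotProduct] at him
    apply Complex.ext
    · rw [Matrix.one_apply]
      simp only [eq_comm (a := j)]
      rw [apply_ite Complex.re, Complex.one_re, Complex.zero_re, ← hre, Complex.re_sum]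
      refine Finset.sum_congr rfl fun i _ => ?_
      simp [Complex.inner, e, Matrix.star_apply]
    · rw [Matrix.one_apply, apply_ite Complex.im]
      simp only [Complex.one_im, Complex.zero_im, ite_self]
      rw [← him]
      rfl
  · rfl

theorem vecMul_ofReal_mem {U : Matrix (Fin 3) (Fin 3) ℂ} {u : Fin 3 → ℂ}
    (hu : u ∈ Submodule.span ℝ (Set.range fun j => U j)) :
    ∃ c : Fin 3 → ℝ, u = Matrix.vecMul (fun j => (c j : ℂ)) U := by
  obtain ⟨c, rfl⟩ := (Submodule.mem_span_range_iff_exists_fun ℝ).mp hu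
  refine ⟨c, ?_⟩
  ext i
  simp [Matrix.vecMul, dotProduct]

theorem linearIndependent_rows_of_unitary {U : Matrix (Fin 3) (Fin 3) ℂ}
    (hU : U ∈ Matrix.unitaryGroup (Fin 3) ℂ) : LinearIndependent ℝ (fun j => U j) := by
  have h : IsUnit U := ⟨Unitary.toUnits ⟨U, hU⟩, rfl⟩
  exact (Matrix.linearIndependent_rows_iff_isUnit.mpr h).restrict_scalars' ℝ

/-- The real span of the rows of a unitary matrix is Lagrangian. -/
theorem lagrangian_span_unitary {U : Matrix (Fin 3) (Fin 3) ℂ}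
    (hU : U ∈ Matrix.unitaryGroup (Fin 3) ℂ) :
    IsLagrangianSubspace (stdSymplecticForm 3) (Submodule.span ℝ (Set.range fun j => U j)) := by
  constructor
  · intro u hu v hv
    obtain ⟨c, rfl⟩ := vecMul_ofReal_mem hu
    obtain ⟨d, rfl⟩ := vecMul_ofReal_mem hv
    rw [stdSymplecticForm_eq_im, Matrix.star_vecMul, Matrix.dotProduct_mulVec, Matrix.vecMul_vecMul,
      ← Matrix.star_eq_conjTranspose, Matrix.mem_unitaryGroup_iff.mp hU, Matrix.vecMul_one]
    simp [dotProduct]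
  · rw [finrank_span_eq_card (linearIndependent_rows_of_unitary hU),
      Module.finrank_eq_card_basis realBasis]
    simp

/-- Membership in `𝒰(ℂ³)` in terms of unitary frames. -/
theorem mem_formsU_iff {Ω : (Fin 3 → ℂ) [⋀^Fin 3]→L[ℝ] ℂ} :
    Ω ∈ formsU 3 (stdSymplecticForm 3) ↔ wedgeForms Ω (stdSymplecticForm 3) = 0 ∧
      ∀ U ∈ Matrix.unitaryGroup (Fin 3) ℂ, Ω (fun j => U j) ≠ 0 := by
  refine and_congr_right fun _ => ⟨fun h U hU h0 => ?_, fun h L hL h0 => ?_⟩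
  · refine h _ (lagrangian_span_unitary hU) ?_
    apply ContinuousAlternatingMap.toAlternatingMap_injective
    have hli := linearIndependent_rows_of_unitary hU
    refine AlternatingMap.ext_of_strictMono (Module.Basis.span hli) fun v hv => ?_
    have h01 : v 0 < v 1 := hv (by decide)
    have h12 : v 1 < v 2 := hv (by decide)
    have hid : v = id := by
      funext i
      fin_cases i <;> simp <;> omega
    rw [hid, Function.comp_id]
    change Ω (fun j => ((Module.Basis.span hli) j : Fin 3 → ℂ)) = 0
    simpa [Module.Basis.span_apply] using h0
  · obtain ⟨U, hU, b, hb⟩ := exists_unitary_of_lagrangian hL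
    refine h U hU ?_
    have := congrArg (fun f => f b) h0
    simpa [hb, Function.comp_def] using this

end Lagrangian

/-! ### The component `𝒰⁺` and the symplectic group -/

section Component
open Complex

theorem wedgeForms_add_smul {Ω Ω' : (Fin 3 → ℂ) [⋀^Fin 3]→L[ℝ] ℂ}
    {ω : (Fin 3 → ℂ) [⋀^Fin 2]→L[ℝ] ℝ} (h : wedgeForms Ω ω = 0) (h' : wedgeForms Ω' ω = 0) (c : ℂ) :
    wedgeForms (Ω + c • Ω') ω = 0 := by
  rw [wedgeForms_eq_zero_iff] at *
  intro v₀ v₁ v₂ v₃ v₄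
  simp only [ContinuousAlternatingMap.add_apply, ContinuousAlternatingMap.smul_apply, smul_eq_mul]
  linear_combination h v₀ v₁ v₂ v₃ v₄ + c * h' v₀ v₁ v₂ v₃ v₄

theorem wedgeForms_conjForm {Ω : (Fin 3 → ℂ) [⋀^Fin 3]→L[ℝ] ℂ}
    {ω : (Fin 3 → ℂ) [⋀^Fin 2]→L[ℝ] ℝ} (h : wedgeForms Ω ω = 0) :
    wedgeForms (conjForm Ω) ω = 0 := by
  rw [wedgeForms_eq_zero_iff] at *
  intro v₀ v₁ v₂ v₃ v₄
  have := congrArg (starRingEnd ℂ) (h v₀ v₁ v₂ v₃ v₄)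
  simpa [conjForm_apply] using this

theorem wedgeForms_comp {Ω : (Fin 3 → ℂ) [⋀^Fin 3]→L[ℝ] ℂ}
    {ω : (Fin 3 → ℂ) [⋀^Fin 2]→L[ℝ] ℝ} (h : wedgeForms Ω ω = 0)
    {g : (Fin 3 → ℂ) →L[ℝ] (Fin 3 → ℂ)} (hg : ∀ u v, ω ![g u, g v] = ω ![u, v]) :
    wedgeForms (Ω.compContinuousLinearMap g) ω = 0 := by
  rw [wedgeForms_eq_zero_iff] at *
  intro v₀ v₁ v₂ v₃ v₄
  have := h (g v₀) (g v₁) (g v₂) (g v₃) (g v₄)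
  simpa only [hg, compContinuousLinearMap_three_apply] using this

theorem formsUPlus_subset {n : ℕ} {V : Type*} [NormedAddCommGroup V] [NormedSpace ℝ V]
    {ω : V [⋀^Fin 2]→L[ℝ] ℝ} : formsUPlus n ω ⊆ formsU n ω := by
  rintro Ω ⟨J, -, Ω₀, -, -, h⟩
  exact connectedComponentIn_subset _ _ h

theorem formsUPlus_of_isPreconnected {n : ℕ} {V : Type*} [NormedAddCommGroup V] [NormedSpace ℝ V]
    {ω : V [⋀^Fin 2]→L[ℝ] ℝ} {Ω Ω' : V [⋀^Fin n]→L[ℝ] ℂ} (hΩ : Ω ∈ formsUPlus n ω)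
    {s : Set (V [⋀^Fin n]→L[ℝ] ℂ)} (hs : IsPreconnected s) (hsub : s ⊆ formsU n ω) (h : Ω ∈ s)
    (h' : Ω' ∈ s) : Ω' ∈ formsUPlus n ω := by
  obtain ⟨J, hJ, Ω₀, hΩ₀, ht, hc⟩ := hΩ
  refine ⟨J, hJ, Ω₀, hΩ₀, ht, ?_⟩
  rw [connectedComponentIn_eq hc]
  exact hs.subset_connectedComponentIn h hsub h'

/-- `𝒰⁺(V)` is stable under displacements along segments inside `𝒰(V)`. -/
theorem formsUPlus_of_segment {n : ℕ} {V : Type*} [NormedAddCommGroup V] [NormedSpace ℝ V]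
    {ω : V [⋀^Fin 2]→L[ℝ] ℝ} {Ω Ω' : V [⋀^Fin n]→L[ℝ] ℂ} (hΩ : Ω ∈ formsUPlus n ω)
    (h : ∀ t : ℝ, 0 ≤ t → t ≤ 1 → Ω + (t : ℂ) • Ω' ∈ formsU n ω) : Ω + Ω' ∈ formsUPlus n ω := by
  refine formsUPlus_of_isPreconnected hΩ (s := (fun t : ℝ => Ω + (t : ℂ) • Ω') '' Set.Icc 0 1)
    (isPreconnected_Icc.image _ (by fun_prop)) ?_ ⟨0, by simp, by ext v; simp⟩
      ⟨1, by simp, by ext v; simp⟩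
  rintro _ ⟨t, ht, rfl⟩
  exact h t ht.1 ht.2

theorem formsU_comp {g : (Fin 3 → ℂ) ≃L[ℝ] (Fin 3 → ℂ)}
    (hg : g ∈ symplecticAut (stdSymplecticForm 3)) {Ω : (Fin 3 → ℂ) [⋀^Fin 3]→L[ℝ] ℂ}
    (hΩ : Ω ∈ formsU 3 (stdSymplecticForm 3)) :
    Ω.compContinuousLinearMap (g : (Fin 3 → ℂ) →L[ℝ] (Fin 3 → ℂ)) ∈
      formsU 3 (stdSymplecticForm 3) := by
  refine ⟨wedgeForms_comp hΩ.1 hg, fun L hL h0 => ?_⟩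
  refine hΩ.2 (L.map (g : (Fin 3 → ℂ) →ₗ[ℝ] (Fin 3 → ℂ))) ⟨?_, ?_⟩ ?_
  · rintro _ ⟨u, hu, rfl⟩ _ ⟨v, hv, rfl⟩
    exact (hg u v).trans (hL.1 u hu v hv)
  · rw [← hL.2]
    congr 1
    exact LinearEquiv.finrank_map_eq g.toLinearEquiv L
  · ext v
    have : ∀ i, ∃ u : L, g u = v i := fun i => by
      obtain ⟨u, hu, h⟩ := (v i).2
      exact ⟨⟨u, hu⟩, h⟩
    choose u hu using this
    have := congrArg (fun f => f u) h0
    simp only [ContinuousAlternatingMap.compContinuousLinearMap_apply] at this ⊢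
    change Ω (fun i => g (u i)) = 0 at this
    change Ω (fun i => (v i : Fin 3 → ℂ)) = 0
    simpa only [hu] using this

/-- `𝒰⁺(ℂ³)` is invariant under the symplectic group. -/
theorem formsUPlus_comp {g : (Fin 3 → ℂ) ≃L[ℝ] (Fin 3 → ℂ)}
    (hg : g ∈ symplecticAut (stdSymplecticForm 3)) {Ω : (Fin 3 → ℂ) [⋀^Fin 3]→L[ℝ] ℂ}
    (hΩ : Ω ∈ formsUPlus 3 (stdSymplecticForm 3)) :
    Ω.compContinuousLinearMap (g : (Fin 3 → ℂ) →L[ℝ] (Fin 3 → ℂ)) ∈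
      formsUPlus 3 (stdSymplecticForm 3) := by
  obtain ⟨J, ⟨hJ1, hJ2, hJ3⟩, Ω₀, hΩ₀, ht, hc⟩ := hΩ
  refine ⟨(g.symm : (Fin 3 → ℂ) →L[ℝ] (Fin 3 → ℂ)).comp
      (J.comp (g : (Fin 3 → ℂ) →L[ℝ] (Fin 3 → ℂ))), ⟨?_, ?_, ?_⟩,
    Ω₀.compContinuousLinearMap g, formsU_comp hg hΩ₀, ?_, ?_⟩
  · intro v
    simp [hJ1]
  · intro u v
    have h := hg (g.symm (J (g u))) (g.symm (J (g v)))
    simp only [ContinuousLinearEquiv.apply_symm_apply] at h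
    exact (h.symm.trans (hJ2 _ _)).trans (hg u v)
  · intro v hv
    have h := hg v (g.symm (J (g v)))
    simp only [ContinuousLinearEquiv.apply_symm_apply] at h
    have h3 := hJ3 (g v) (by simpa using hv)
    rw [h] at h3
    exact h3
  · intro v i
    have h := ht (g ∘ v) i
    simp only [ContinuousAlternatingMap.compContinuousLinearMap_apply]
    refine Eq.trans (congrArg Ω₀ ?_) h
    funext k
    by_cases hk : k = i
    · subst hk; simp
    · simp [hk]
  · have hpre : IsPreconnected ((ContinuousAlternatingMap.compContinuousLinearMapCLM (F := ℂ)
        (ι := Fin 3) (𝕜 := ℝ) (g : (Fin 3 → ℂ) →L[ℝ] (Fin 3 → ℂ))) ''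
        connectedComponentIn (formsU 3 (stdSymplecticForm 3)) Ω₀) :=
      isPreconnected_connectedComponentIn.image _ (ContinuousLinearMap.continuous _).continuousOn
    refine hpre.subset_connectedComponentIn ⟨Ω₀, mem_connectedComponentIn hΩ₀, rfl⟩ ?_ ⟨Ω, hc, rfl⟩
    rintro _ ⟨Ω', h', rfl⟩
    exact formsU_comp hg (connectedComponentIn_subset _ _ h')

end Component

/-! ### Polynomials without zeros on polydiscs -/

section MultiAffine
open Complex

/-- If an affine function has no zero on the closed unit disc, its constant term dominates. -/
theorem norm_lt_of_affine_ne_zero {α β : ℂ} (h : ∀ w : ℂ, ‖w‖ ≤ 1 → α + β * w ≠ 0) :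
    ‖β‖ < ‖α‖ := by
  by_contra! hle
  by_cases hβ : β = 0
  · subst hβ
    have : α = 0 := by simpa using hle
    exact h 0 (by simp) (by simp [this])
  · refine h (-α / β) ?_ ?_
    · rw [norm_div, norm_neg]
      exact div_le_one_of_le₀ hle (norm_nonneg _)
    · field_simp
      ring

theorem affine_ne_zero_of_norm_lt {α β : ℂ} (h : ‖β‖ < ‖α‖) (w : ℂ) (hw : ‖w‖ ≤ 1) :
    α + β * w ≠ 0 := by
  intro h0
  have : α = -(β * w) := by linear_combination h0
  rw [this, norm_neg, norm_mul] at h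
  nlinarith [norm_nonneg β]

/-- An affine function without zeros on the unit circle has coefficients of different moduli. -/
theorem norm_ne_of_affine_ne_zero {α β : ℂ} (h : ∀ w : ℂ, ‖w‖ = 1 → α + β * w ≠ 0) :
    ‖α‖ ≠ ‖β‖ := by
  intro he
  by_cases hβ : β = 0
  · subst hβ
    have : α = 0 := by simpa using he
    exact h 1 (by simp) (by simp [this])
  · refine h (-α / β) ?_ ?_
    · rw [norm_div, norm_neg, he, div_self (by simpa using hβ)]
    · field_simp
      ring

/-- A bi-affine polynomial without zeros on (disc × circle) and (circle × disc) has no zeros on the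
bidisc: the sign of `|p + q w₁| - |r + t w₁|` is constant for `w₁` in the disc. -/
theorem biaffine_ne_zero {p q r t : ℂ}
    (h1 : ∀ w₁ w₂ : ℂ, ‖w₁‖ ≤ 1 → ‖w₂‖ = 1 → p + q * w₁ + (r + t * w₁) * w₂ ≠ 0)
    (h2 : ∀ w₁ w₂ : ℂ, ‖w₁‖ = 1 → ‖w₂‖ ≤ 1 → p + q * w₁ + (r + t * w₁) * w₂ ≠ 0)
    (w₁ w₂ : ℂ) (hw₁ : ‖w₁‖ ≤ 1) (hw₂ : ‖w₂‖ ≤ 1) :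
    p + q * w₁ + (r + t * w₁) * w₂ ≠ 0 := by
  refine affine_ne_zero_of_norm_lt ?_ w₂ hw₂
  have hne : ∀ w : ℂ, ‖w‖ ≤ 1 → ‖p + q * w‖ - ‖r + t * w‖ ≠ 0 := fun w hw =>
    sub_ne_zero.mpr (norm_ne_of_affine_ne_zero fun w₂ hw₂ => h1 w w₂ hw hw₂)
  have hpos : 0 < ‖p + q * 1‖ - ‖r + t * 1‖ :=
    sub_pos.mpr (norm_lt_of_affine_ne_zero fun w₂ hw₂ => h2 1 w₂ (by simp) hw₂)
  by_contra! hle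
  have hpc : IsPreconnected (Metric.closedBall (0 : ℂ) 1) :=
    (convex_closedBall (0 : ℂ) 1).isPreconnected
  obtain ⟨w, hw, hw0⟩ := hpc.intermediate_value (a := w₁) (b := 1) (by simpa using hw₁) (by simp)
    (f := fun w => ‖p + q * w‖ - ‖r + t * w‖) (by fun_prop)
    (show (0 : ℝ) ∈ Set.Icc _ _ from ⟨by simpa using hle, hpos.le⟩)
  exact hne w (by simpa using hw) hw0

/-- Asano contraction: if `p + q w₁ + r w₂ + t w₁ w₂` has no zero on the bidisc then
`p + t w` has no zero on the disc. -/
theorem asano_contraction {p q r t : ℂ}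
    (h : ∀ w₁ w₂ : ℂ, ‖w₁‖ ≤ 1 → ‖w₂‖ ≤ 1 → p + q * w₁ + (r + t * w₁) * w₂ ≠ 0) :
    ‖t‖ < ‖p‖ := by
  have h1 : ∀ w : ℂ, ‖w‖ ≤ 1 → ‖r + t * w‖ < ‖p + q * w‖ := fun w hw =>
    norm_lt_of_affine_ne_zero fun w₂ hw₂ => h w w₂ hw hw₂
  have h2 : ∀ w : ℂ, ‖w‖ ≤ 1 → ‖q + t * w‖ < ‖p + r * w‖ := fun w hw =>
    norm_lt_of_affine_ne_zero fun w₁ hw₁ => by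
      have := h w₁ w hw₁ hw
      contrapose! this
      linear_combination this
  -- sum the inequalities at `w = 1` and `w = -1`, using the parallelogram law
  have par : ∀ x y : ℂ, ‖x + y * 1‖ ^ 2 + ‖x + y * (-1)‖ ^ 2 = 2 * (‖x‖ ^ 2 + ‖y‖ ^ 2) := by
    intro x y
    have := parallelogram_law_with_norm ℝ x y
    simp only [mul_one, mul_neg, ← sub_eq_add_neg]
    linarith
  have sq : ∀ {x y : ℂ}, ‖x‖ < ‖y‖ → ‖x‖ ^ 2 < ‖y‖ ^ 2 := fun hxy => by gcongr
  have a1 := sq (h1 1 (by simp))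
  have a2 := sq (h1 (-1) (by simp))
  have b1 := sq (h2 1 (by simp))
  have b2 := sq (h2 (-1) (by simp))
  have := par r t
  have := par p q
  have := par q t
  have := par p r
  have hlt : ‖t‖ ^ 2 < ‖p‖ ^ 2 := by linarith
  exact lt_of_pow_lt_pow_left₀ 2 (norm_nonneg _) hlt

/-- The polynomial `a + ∑ tⱼ wⱼ + ∑ sⱼ wₖ wₗ + b w₁ w₂ w₃`. -/
def triaffine (a b : ℂ) (s t w : Fin 3 → ℂ) : ℂ :=
  a + t 0 * w 0 + t 1 * w 1 + t 2 * w 2 + s 0 * (w 1 * w 2) + s 1 * (w 2 * w 0)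
    + s 2 * (w 0 * w 1) + b * (w 0 * w 1 * w 2)

/-- If a polynomial of degree one in each of three variables has no zero when two of them are on the
unit circle and the third one is in the disc, it has no zero on the polydisc. -/
theorem triaffine_ne_zero {a b : ℂ} {s t : Fin 3 → ℂ}
    (h : ∀ (j : Fin 3) (w : Fin 3 → ℂ), (∀ k, k ≠ j → ‖w k‖ = 1) → ‖w j‖ ≤ 1 →
      triaffine a b s t w ≠ 0) (w : Fin 3 → ℂ) (hw : ∀ k, ‖w k‖ ≤ 1) :
    triaffine a b s t w ≠ 0 := by
  have h01 : ∀ x y z : ℂ, ‖x‖ ≤ 1 → ‖y‖ ≤ 1 → ‖z‖ = 1 → triaffine a b s t ![x, y, z] ≠ 0 := by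
    intro x y z hx hy hz
    have := biaffine_ne_zero (p := a + t 2 * z) (q := t 0 + s 1 * z) (r := t 1 + s 0 * z)
      (t := s 2 + b * z) (fun x y hx hy => ?_) (fun x y hx hy => ?_) x y hx hy
    · intro h0; apply this; simp [triaffine] at h0; linear_combination h0
    · have := h 0 ![x, y, z] (fun k hk => by fin_cases k <;> simp_all) (by simpa using hx)
      intro h0; apply this; simp [triaffine]; linear_combination h0
    · have := h 1 ![x, y, z] (fun k hk => by fin_cases k <;> simp_all) (by simpa using hy)
      intro h0; apply this; simp [triaffine]; linear_combination h0
  have h12 : ∀ x y z : ℂ, ‖x‖ = 1 → ‖y‖ ≤ 1 → ‖z‖ ≤ 1 → triaffine a b s t ![x, y, z] ≠ 0 := by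
    intro x y z hx hy hz
    have := biaffine_ne_zero (p := a + t 0 * x) (q := t 1 + s 2 * x) (r := t 2 + s 1 * x)
      (t := s 0 + b * x) (fun y z hy hz => ?_) (fun y z hy hz => ?_) y z hy hz
    · intro h0; apply this; simp [triaffine] at h0; linear_combination h0
    · have := h 1 ![x, y, z] (fun k hk => by fin_cases k <;> simp_all) (by simpa using hy)
      intro h0; apply this; simp [triaffine]; linear_combination h0
    · have := h 2 ![x, y, z] (fun k hk => by fin_cases k <;> simp_all) (by simpa using hz)
      intro h0; apply this; simp [triaffine]; linear_combination h0
  have hw3 : w = ![w 0, w 1, w 2] := by funext i; fin_cases i <;> rfl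
  have := biaffine_ne_zero (p := a + t 1 * w 1) (q := t 0 + s 2 * w 1) (r := t 2 + s 0 * w 1)
      (t := s 1 + b * w 1) (fun x z hx hz => ?_) (fun x z hx hz => ?_) (w 0) (w 2) (hw 0) (hw 2)
  · intro h0; apply this; simp only [triaffine] at h0; linear_combination h0
  · have := h01 x (w 1) z hx (hw 1) hz
    intro h0; apply this; simp [triaffine]; linear_combination h0
  · have := h12 x (w 1) z hx (hw 1) hz
    intro h0; apply this; simp [triaffine]; linear_combination h0

/-- For a polynomial of degree one in each of three variables without zeros on the polydisc, the
constant term dominates the leading one: contract the first two variables, then the third one with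
the resulting variable. -/
theorem norm_lt_of_triaffine_ne_zero {a b : ℂ} {s t : Fin 3 → ℂ}
    (h : ∀ w : Fin 3 → ℂ, (∀ k, ‖w k‖ ≤ 1) → triaffine a b s t w ≠ 0) : ‖b‖ < ‖a‖ := by
  have h1 : ∀ z : ℂ, ‖z‖ ≤ 1 → ‖s 2 + b * z‖ < ‖a + t 2 * z‖ := by
    intro z hz
    refine asano_contraction (q := t 0 + s 1 * z) (r := t 1 + s 0 * z) fun x y hx hy h0 => ?_
    refine h ![x, y, z] (fun k => by fin_cases k <;> simpa) ?_
    simp [triaffine]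
    linear_combination h0
  refine asano_contraction (q := t 2) (r := s 2) fun z w hz hw => ?_
  exact affine_ne_zero_of_norm_lt (h1 z hz) w hw

end MultiAffine

/-! ### Domination of the `(0, 3)`-part by the `(3, 0)`-part -/

section Domination
open Complex

theorem diagonal_mem_unitaryGroup {c : Fin 3 → ℂ} (hc : ∀ k, ‖c k‖ = 1) :
    Matrix.diagonal c ∈ Matrix.unitaryGroup (Fin 3) ℂ := by
  rw [Matrix.mem_unitaryGroup_iff, Matrix.star_eq_conjTranspose, Matrix.diagonal_conjTranspose,
    Matrix.diagonal_mul_diagonal, ← Matrix.diagonal_one]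
  congr 1
  funext k
  simp [Complex.mul_conj, Complex.normSq_eq_norm_sq, hc]

theorem ne_zero_on_diagonal_frame {Ω : (Fin 3 → ℂ) [⋀^Fin 3]→L[ℝ] ℂ}
    (hΩ : Ω ∈ formsU 3 (stdSymplecticForm 3)) {c : Fin 3 → ℂ} (hc : ∀ k, ‖c k‖ = 1) :
    Ω (fun k => Pi.single k (c k)) ≠ 0 := by
  have h := (mem_formsU_iff.mp hΩ).2 _ (diagonal_mem_unitaryGroup hc)
  have e : (fun k => Matrix.diagonal c k) = fun k => (Pi.single k (c k) : Fin 3 → ℂ) := by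
    funext k i
    simp [Matrix.diagonal_apply, Pi.single_apply, eq_comm]
  rwa [e] at h

/-- For a form of type `(3, 0)` with respect to a compatible complex structure, and two orthogonal
unit vectors in coordinate lines, the partial evaluation on the remaining coordinate line preserves
the orientation. Indeed the real part of that functional is `ω(·, m)` for some `m`, its imaginary
part is then `-ω(·, n)` with `n = -J m`, and its Jacobian on the line is `ω(n, J n)`. -/
theorem im_nonneg_of_topHolomorphic {J : (Fin 3 → ℂ) →L[ℝ] (Fin 3 → ℂ)}
    (hJ : IsCompatibleComplexStructure (stdSymplecticForm 3) J)
    {Ω : (Fin 3 → ℂ) [⋀^Fin 3]→L[ℝ] ℂ} (hΩ : IsTopHolomorphicType J Ω)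
    (c : Fin 3 → ℂ) (hc : ∀ k, ‖c k‖ = 1) (j : Fin 3) :
    0 ≤ ((starRingEnd ℂ) (Ω (Function.update (fun k => Pi.single k (c k)) j (Pi.single j 1))) *
      Ω (Function.update (fun k => Pi.single k (c k)) j (Pi.single j I))).im := by
  set y : Fin 3 → Fin 3 → ℂ := fun k => Pi.single k (c k) with hy
  let lam : (Fin 3 → ℂ) →ₗ[ℝ] ℂ := Ω.toMultilinearMap.toLinearMap y j
  have hlam : ∀ v, lam v = Ω (Function.update y j v) := fun v => rfl
  rw [← hlam, ← hlam]
  have hlamJ : ∀ v, lam (J v) = I * lam v := by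
    intro v
    have := hΩ (Function.update y j v) j
    rw [hlam, hlam]
    simpa using this
  have hker : ∀ k, k ≠ j → lam (y k) = 0 := by
    intro k hk
    rw [hlam]
    refine Ω.map_eq_zero_of_eq _ (i := k) (j := j) ?_ hk
    simp [hk]
  -- the vector `m` representing the real part of `lam`
  obtain ⟨m, hm⟩ : ∃ m, ∀ v, (lam v).re = stdSymplecticForm 3 ![v, m] := by
    refine ⟨fun k => ⟨-(lam (Pi.single k I)).re, (lam (Pi.single k 1)).re⟩, fun v => ?_⟩
    have hv : v = ∑ k, ((v k).re • (Pi.single k 1 : Fin 3 → ℂ) +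
        (v k).im • (Pi.single k I : Fin 3 → ℂ)) := by
      ext i
      simp [Finset.sum_apply, Pi.single_apply, Finset.sum_add_distrib, Complex.re_add_im]
    conv_lhs => rw [hv]
    rw [stdSymplecticForm_apply, map_sum, Complex.re_sum]
    refine Finset.sum_congr rfl fun k _ => ?_
    simp
  obtain ⟨hJ1, hJ2, hJ3⟩ := hJ
  set n := -J m with hn
  have hJn : J n = m := by rw [hn, map_neg, hJ1, neg_neg]
  have him : ∀ v, (lam v).im = -stdSymplecticForm 3 ![v, n] := by
    intro v
    have h1 : (lam (J v)).re = -(lam v).im := by rw [hlamJ]; simp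
    rw [hm, ← hJn, hJ2] at h1
    linarith
  have hnn : 0 ≤ stdSymplecticForm 3 ![n, m] := by
    by_cases h0 : n = 0
    · rw [h0, stdSymplecticForm_apply]; simp
    · rw [← hJn]; exact (hJ3 n h0).le
  -- in the other coordinate lines `m` and `n` are both real multiples of `c k`, so only the `j`-th
  -- coordinate contributes to `ω(n, m)`
  have hk1 : ∀ k, k ≠ j → (c k).re * (m k).im - (c k).im * (m k).re = 0 := by
    intro k hk
    have := hm (y k)
    rw [hker k hk, stdSymplecticForm_apply, Finset.sum_eq_single k] at this
    · simpa [hy] using this.symm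
    · intro i _ hi; simp [hy, hi]
    · simp
  have hk2 : ∀ k, k ≠ j → (c k).re * (n k).im - (c k).im * (n k).re = 0 := by
    intro k hk
    have := him (y k)
    rw [hker k hk, stdSymplecticForm_apply, Finset.sum_eq_single k] at this
    · simp [hy] at this
      linarith
    · intro i _ hi; simp [hy, hi]
    · simp
  have hk3 : ∀ k, k ≠ j → (n k).re * (m k).im - (n k).im * (m k).re = 0 := by
    intro k hk
    have h1 := hk1 k hk
    have h2 := hk2 k hk
    have h3 : (c k).re ^ 2 + (c k).im ^ 2 = 1 := by
      have := Complex.sq_norm (c k)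
      rw [hc, Complex.normSq_apply] at this
      nlinarith
    linear_combination (-((n k).re * (m k).im - (n k).im * (m k).re)) * h3
      + ((c k).re * (n k).re + (c k).im * (n k).im) * h1
      - ((c k).re * (m k).re + (c k).im * (m k).im) * h2
  have hsum : stdSymplecticForm 3 ![n, m] = (n j).re * (m j).im - (n j).im * (m j).re := by
    rw [stdSymplecticForm_apply, Finset.sum_eq_single j]
    · intro k _ hk; exact hk3 k hk
    · simp
  have e1 : lam (Pi.single j 1) = ⟨(m j).im, -(n j).im⟩ := by
    apply Complex.ext
    · rw [hm, stdSymplecticForm_apply, Finset.sum_eq_single j]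
      · simp
      · intro i _ hi; simp [hi]
      · simp
    · rw [him, stdSymplecticForm_apply, Finset.sum_eq_single j]
      · simp
      · intro i _ hi; simp [hi]
      · simp
  have e2 : lam (Pi.single j I) = ⟨-(m j).re, (n j).re⟩ := by
    apply Complex.ext
    · rw [hm, stdSymplecticForm_apply, Finset.sum_eq_single j]
      · simp
      · intro i _ hi; simp [hi]
      · simp
    · rw [him, stdSymplecticForm_apply, Finset.sum_eq_single j]
      · simp
      · intro i _ hi; simp [hi]
      · simp
  rw [e1, e2]
  rw [hsum] at hnn
  simp
  linarith

/-- The orientation property of forms of type `(3, 0)` persists on `𝒰⁺(ℂ³)`, because the Jacobian in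
question does not vanish on `𝒰(ℂ³)`. -/
theorem im_pos_of_formsUPlus {Ω : (Fin 3 → ℂ) [⋀^Fin 3]→L[ℝ] ℂ}
    (hΩ : Ω ∈ formsUPlus 3 (stdSymplecticForm 3)) (c : Fin 3 → ℂ) (hc : ∀ k, ‖c k‖ = 1)
    (j : Fin 3) :
    0 < ((starRingEnd ℂ) (Ω (Function.update (fun k => Pi.single k (c k)) j (Pi.single j 1))) *
      Ω (Function.update (fun k => Pi.single k (c k)) j (Pi.single j I))).im := by
  obtain ⟨J, hJ, Ω₀, hΩ₀, ht, hcc⟩ := hΩ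
  set f : ((Fin 3 → ℂ) [⋀^Fin 3]→L[ℝ] ℂ) → ℝ := fun Ω =>
    ((starRingEnd ℂ) (Ω (Function.update (fun k => Pi.single k (c k)) j (Pi.single j 1))) *
      Ω (Function.update (fun k => Pi.single k (c k)) j (Pi.single j I))).im with hf
  have hcont : Continuous f := by
    have h1 : ∀ v : Fin 3 → Fin 3 → ℂ,
        Continuous fun Ω : (Fin 3 → ℂ) [⋀^Fin 3]→L[ℝ] ℂ => Ω v := fun v => continuous_eval_const v
    exact Complex.continuous_im.comp ((Complex.continuous_conj.comp (h1 _)).mul (h1 _))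
  have hne : ∀ Ω ∈ formsU 3 (stdSymplecticForm 3), f Ω ≠ 0 := by
    intro Ω hΩ h0
    set y : Fin 3 → Fin 3 → ℂ := fun k => Pi.single k (c k) with hy
    let lam : (Fin 3 → ℂ) →ₗ[ℝ] ℂ := Ω.toMultilinearMap.toLinearMap y j
    have hlam : ∀ v, lam v = Ω (Function.update y j v) := fun v => rfl
    -- the functional does not vanish on the `j`-th coordinate line, since each of its vectors
    -- completes the other ones to a frame of a Lagrangian subspace
    have hz : ∀ z : ℂ, z ≠ 0 → lam (Pi.single j z) ≠ 0 := by
      intro z hz h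
      have hn : ‖z‖ ≠ 0 := by simpa using hz
      have h2 : lam (Pi.single j ((‖z‖⁻¹ : ℝ) • z)) = 0 := by
        rw [Pi.single_smul, map_smul, h, smul_zero]
      refine ne_zero_on_diagonal_frame hΩ (c := Function.update c j ((‖z‖⁻¹ : ℝ) • z)) ?_ ?_
      · intro k
        by_cases hk : k = j
        · subst hk
          rw [Function.update_self, norm_smul, norm_inv, norm_norm, inv_mul_cancel₀ hn]
        · rw [Function.update_of_ne hk, hc]
      · rw [← h2, hlam]
        congr 1
        funext k
        by_cases hk : k = j
        · subst hk; simp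
        · simp [hk, hy]
    have hlin : ∀ s t : ℝ, lam (Pi.single j ⟨s, t⟩) =
        s * lam (Pi.single j 1) + t * lam (Pi.single j I) := by
      intro s t
      have : (Pi.single j ⟨s, t⟩ : Fin 3 → ℂ) =
          s • (Pi.single j 1 : Fin 3 → ℂ) + t • (Pi.single j I : Fin 3 → ℂ) := by
        rw [← Pi.single_smul, ← Pi.single_smul, ← Pi.single_add]
        congr 1
        apply Complex.ext <;> simp
      rw [this, map_add, map_smul, map_smul, Complex.real_smul, Complex.real_smul]
    have hp : lam (Pi.single j 1) ≠ 0 := hz 1 one_ne_zero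
    have hr : lam (Pi.single j I) ≠ 0 := hz I I_ne_zero
    have h0' : ((starRingEnd ℂ) (lam (Pi.single j 1)) * lam (Pi.single j I)).im = 0 := h0
    -- the two values are real multiples of each other
    have hnp : 0 < Complex.normSq (lam (Pi.single j 1)) := Complex.normSq_pos.mpr hp
    refine hz ⟨-((starRingEnd ℂ) (lam (Pi.single j 1)) * lam (Pi.single j I)).re,
      Complex.normSq (lam (Pi.single j 1))⟩ (fun h => ?_) ?_
    · have := congrArg Complex.im h
      simp at this
      exact hp (by simpa [hlam] using this)
    · rw [hlin]
      have hre : ((((starRingEnd ℂ) (lam (Pi.single j 1)) * lam (Pi.single j I)).re : ℝ) : ℂ) =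
          (starRingEnd ℂ) (lam (Pi.single j 1)) * lam (Pi.single j I) := by
        apply Complex.ext
        · simp
        · rw [h0']; simp
      push_cast [hre, ← Complex.mul_conj]
      ring
  by_contra! hle
  obtain ⟨Ω', hΩ', h0⟩ := isPreconnected_connectedComponentIn.intermediate_value hcc
    (mem_connectedComponentIn hΩ₀) hcont.continuousOn
    (show (0 : ℝ) ∈ Set.Icc (f Ω) (f Ω₀) from ⟨hle, im_nonneg_of_topHolomorphic hJ ht c hc j⟩)
  exact hne Ω' (connectedComponentIn_subset _ _ hΩ') h0

/-- Values on the Lagrangian frames which are diagonal with respect to the standard basis. Only the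
diagonal coefficients matter. -/
theorem dolbeaultForm_diagonal_frame (a b : ℂ) (S T : Matrix (Fin 3) (Fin 3) ℂ) {c : Fin 3 → ℂ}
    (hc : ∀ k, ‖c k‖ = 1) :
    dolbeaultForm a b S T (fun k => Pi.single k (c k)) =
      c 0 * c 1 * c 2 * triaffine a b (fun j => S j j) (fun j => T j j)
        (fun k => (starRingEnd ℂ) (c k) ^ 2) := by
  have e : (fun k => (Pi.single k (c k) : Fin 3 → ℂ)) =
      ![Pi.single 0 (c 0), Pi.single 1 (c 1), Pi.single 2 (c 2)] := by
    funext k; fin_cases k <;> rfl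
  have h : ∀ k, c k * (starRingEnd ℂ) (c k) = 1 := by
    intro k
    rw [Complex.mul_conj, Complex.normSq_eq_norm_sq, hc]; simp
  have hne : ∀ k, c k ≠ 0 := fun k h0 => by simpa [h0] using h k
  have hinv : ∀ k, (starRingEnd ℂ) (c k) = (c k)⁻¹ := fun k =>
    eq_inv_of_mul_eq_one_right (h k)
  have h0 := hne 0
  have h1 := hne 1
  have h2 := hne 2
  rw [e]
  simp [dolbeaultForm, Fin.sum_univ_three, wedgeCovectors_three_apply, dz, dzbar, triaffine, hinv]
  field_simp
  ring

theorem exists_conj_sq_eq {w : ℂ} (hw : ‖w‖ = 1) :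
    ∃ c : ℂ, ‖c‖ = 1 ∧ (starRingEnd ℂ) c ^ 2 = w := by
  obtain ⟨z, hz⟩ := IsAlgClosed.exists_pow_nat_eq w (n := 2) (by norm_num)
  refine ⟨(starRingEnd ℂ) z, ?_, by simpa using hz⟩
  rw [RCLike.norm_conj]
  rw [← hz, norm_pow] at hw
  exact (pow_eq_one_iff_of_nonneg (norm_nonneg _) two_ne_zero).mp hw

/-- The polynomial of the diagonal coefficients of a form in `𝒰⁺(ℂ³)` has no zero on the closed
polydisc. On the torus its values are those of the form on Lagrangian frames; when a single variable
moves into the disc, it is affine in that variable, and the constant term dominates because the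
partial evaluations of the form preserve the orientation. -/
theorem triaffine_ne_zero_of_formsUPlus {a b : ℂ} {S T : Matrix (Fin 3) (Fin 3) ℂ}
    (hΩ : dolbeaultForm a b S T ∈ formsUPlus 3 (stdSymplecticForm 3)) (w : Fin 3 → ℂ)
    (hw : ∀ k, ‖w k‖ ≤ 1) : triaffine a b (fun j => S j j) (fun j => T j j) w ≠ 0 := by
  refine triaffine_ne_zero (fun j w hw hwj => ?_) w hw
  have hex : ∀ k, ∃ c : ℂ, ‖c‖ = 1 ∧ (k ≠ j → (starRingEnd ℂ) c ^ 2 = w k) := by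
    intro k
    by_cases hk : k = j
    · exact ⟨1, by simp, fun h => absurd hk h⟩
    · obtain ⟨c, h1, h2⟩ := exists_conj_sq_eq (hw k hk)
      exact ⟨c, h1, fun _ => h2⟩
  choose c hc hcw using hex
  set q := triaffine a b (fun j => S j j) (fun j => T j j) with hq
  set α := q (Function.update w j 0) with hα
  set β := q (Function.update w j 1) - α with hβ
  have hαβ : ∀ z, q (Function.update w j z) = α + β * z := by
    intro z
    rw [hβ, hα, hq]
    fin_cases j <;> simp [triaffine] <;> ring
  have hval : ∀ z : ℂ, ‖z‖ = 1 →
      dolbeaultForm a b S T (Function.update (fun k => Pi.single k (c k)) j (Pi.single j z)) =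
        z * (∏ k ∈ Finset.univ.erase j, c k) * (α + β * (starRingEnd ℂ) z ^ 2) := by
    intro z hz
    have hcz : ∀ k, ‖Function.update c j z k‖ = 1 := by
      intro k
      by_cases hk : k = j
      · subst hk; simpa using hz
      · simpa [hk] using hc k
    have h := dolbeaultForm_diagonal_frame a b S T hcz
    have e1 : (fun k => (Pi.single k (Function.update c j z k) : Fin 3 → ℂ)) =
        Function.update (fun k => Pi.single k (c k)) j (Pi.single j z) := by
      funext k
      by_cases hk : k = j
      · subst hk; simp
      · simp [hk]
    have e2 : (fun k => (starRingEnd ℂ) (Function.update c j z k) ^ 2) =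
        Function.update w j ((starRingEnd ℂ) z ^ 2) := by
      funext k
      by_cases hk : k = j
      · subst hk; simp
      · simpa [hk] using hcw k hk
    have e3 : Function.update c j z 0 * Function.update c j z 1 * Function.update c j z 2 =
        z * ∏ k ∈ Finset.univ.erase j, c k := by
      rw [← Fin.prod_univ_three, ← Finset.mul_prod_erase _ _ (Finset.mem_univ j),
        Function.update_self]
      congr 1
      refine Finset.prod_congr rfl fun k hk => ?_
      rw [Function.update_of_ne (Finset.ne_of_mem_erase hk)]
    rw [e1, e2, e3, ← hq, hαβ] at h
    exact h
  -- the Jacobian of the partial evaluation is `|α|² - |β|²`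
  have hpos := im_pos_of_formsUPlus hΩ c hc j
  rw [hval 1 (by simp), hval I (by simp)] at hpos
  set C := ∏ k ∈ Finset.univ.erase j, c k with hC
  have hCn : ‖C‖ = 1 := by rw [hC, norm_prod]; simp [hc]
  have hCC : C.re * C.re + C.im * C.im = 1 := by
    rw [← Complex.normSq_apply, Complex.normSq_eq_norm_sq, hCn]; norm_num
  have hnorm : ‖β‖ ^ 2 < ‖α‖ ^ 2 := by
    rw [← Complex.normSq_eq_norm_sq, ← Complex.normSq_eq_norm_sq, Complex.normSq_apply,
      Complex.normSq_apply]
    have e : ((starRingEnd ℂ) (1 * C * (α + β * (starRingEnd ℂ) 1 ^ 2)) *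
        (I * C * (α + β * (starRingEnd ℂ) I ^ 2))).im =
        (C.re * C.re + C.im * C.im) *
          ((α.re * α.re + α.im * α.im) - (β.re * β.re + β.im * β.im)) := by
      simp [Complex.mul_re, Complex.mul_im, pow_two]
      ring
    rw [e, hCC] at hpos
    linarith
  have hw' : w = Function.update w j (w j) := by simp
  rw [hw', hαβ]
  exact affine_ne_zero_of_norm_lt (lt_of_pow_lt_pow_left₀ 2 (norm_nonneg _) hnorm) _ hwj

/-- On `𝒰⁺(ℂ³)` the `(3, 0)`-part dominates the `(0, 3)`-part. -/
theorem norm_coeffB_lt_norm_coeffA {Ω : (Fin 3 → ℂ) [⋀^Fin 3]→L[ℝ] ℂ}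
    (hΩ : Ω ∈ formsUPlus 3 (stdSymplecticForm 3)) : ‖coeffB Ω‖ < ‖coeffA Ω‖ := by
  rw [eq_dolbeaultForm Ω] at hΩ
  exact norm_lt_of_triaffine_ne_zero (triaffine_ne_zero_of_formsUPlus hΩ)

end Domination

/-! ### Normal forms and small perturbations -/

section Perturbation
open Complex

theorem normalForm_eq_dolbeaultForm (γ₁ γ₂ γ₃ : ℝ) :
    normalForm γ₁ γ₂ γ₃ = dolbeaultForm 1 0
      (Matrix.diagonal ![(γ₁ : ℂ), γ₂, γ₃]) 0 := by
  have hrot : ∀ (f g h : (Fin 3 → ℂ) →L[ℝ] ℂ), wedgeCovectors ![f, g, h] =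
      wedgeCovectors ![g, h, f] := by
    intro f g h
    ext v
    have hv : v = ![v 0, v 1, v 2] := by funext i; fin_cases i <;> rfl
    rw [hv, wedgeCovectors_three_apply, wedgeCovectors_three_apply]
    ring
  ext v
  simp only [normalForm, dolbeaultForm, Fin.sum_univ_three, Matrix.diagonal_apply]
  rw [hrot (dzbar 0) (dz 1) (dzbar 2), ← hrot (dz 2) (dzbar 0) (dzbar 1)]
  simp
  ring

set_option maxHeartbeats 1000000 in
theorem wedgeForms_normalForm (γ₁ γ₂ γ₃ : ℝ) :
    wedgeForms (normalForm γ₁ γ₂ γ₃) (stdSymplecticForm 3) = 0 := by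
  have hω : ∀ u v : Fin 3 → ℂ, ((stdSymplecticForm 3 ![u, v] : ℝ) : ℂ) =
      (u 0 * (starRingEnd ℂ) (v 0) - (starRingEnd ℂ) (u 0) * v 0
        + (u 1 * (starRingEnd ℂ) (v 1) - (starRingEnd ℂ) (u 1) * v 1)
        + (u 2 * (starRingEnd ℂ) (v 2) - (starRingEnd ℂ) (u 2) * v 2)) * (I / 2) := by
    intro u v
    rw [stdSymplecticForm_apply, Fin.sum_univ_three]
    apply Complex.ext
    · simp
      ring
    · simp
  have key : ∀ f g h : (Fin 3 → ℂ) →L[ℝ] ℂ, ([f, g, h] = [dz 0, dz 1, dz 2] ∨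
      [f, g, h] = [dz 0, dzbar 1, dzbar 2] ∨ [f, g, h] = [dzbar 0, dz 1, dzbar 2] ∨
      [f, g, h] = [dzbar 0, dzbar 1, dz 2]) →
      wedgeForms (wedgeCovectors ![f, g, h]) (stdSymplecticForm 3) = 0 := by
    intro f g h hfgh
    rw [wedgeForms_eq_zero_iff]
    intro v₀ v₁ v₂ v₃ v₄
    rcases hfgh with h | h | h | h <;> simp only [List.cons.injEq, and_true] at h <;>
      obtain ⟨rfl, rfl, rfl⟩ := h <;>
      simp only [wedgeCovectors_three_apply, hω, dz, dzbar, ContinuousLinearMap.proj_apply,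
        ContinuousLinearMap.comp_apply, ContinuousLinearEquiv.coe_coe, Complex.conjCLE_apply] <;>
      ring
  have hr : ∀ (r : ℝ) (Ω : (Fin 3 → ℂ) [⋀^Fin 3]→L[ℝ] ℂ), r • Ω = (r : ℂ) • Ω := by
    intro r Ω; ext v; simp
  rw [normalForm, hr, hr, hr]
  exact wedgeForms_add_smul (wedgeForms_add_smul (wedgeForms_add_smul (key _ _ _ (by simp))
    (key _ _ _ (by simp)) _) (key _ _ _ (by simp)) _) (key _ _ _ (by simp)) _

/-- The holomorphic volume form `dz₁ ∧ dz₂ ∧ dz₃`. -/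
def holVol : (Fin 3 → ℂ) [⋀^Fin 3]→L[ℝ] ℂ := wedgeCovectors ![dz 0, dz 1, dz 2]

theorem holVol_eq_normalForm : holVol = normalForm 0 0 0 := by
  ext v
  simp [holVol, normalForm]

theorem holVol_apply (v : Fin 3 → Fin 3 → ℂ) : holVol v = (Matrix.of v).det := by
  rw [holVol, wedgeCovectors_apply, ← Matrix.det_transpose]
  congr 1
  ext i j
  fin_cases j <;> rfl

theorem norm_det_of_unitary {U : Matrix (Fin 3) (Fin 3) ℂ}
    (hU : U ∈ Matrix.unitaryGroup (Fin 3) ℂ) : ‖U.det‖ = 1 := by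
  have := Matrix.det_of_mem_unitary hU
  exact CStarRing.norm_of_mem_unitary this

theorem isCompact_unitaryGroup (n : ℕ) :
    IsCompact (Matrix.unitaryGroup (Fin n) ℂ : Set (Matrix (Fin n) (Fin n) ℂ)) := by
  refine IsCompact.of_isClosed_subset (isCompact_univ_pi fun _ => isCompact_univ_pi fun _ =>
    isCompact_closedBall (0 : ℂ) 1) (isClosed_unitary (R := Matrix (Fin n) (Fin n) ℂ)) ?_
  intro U hU i _ j _
  simpa using entry_norm_bound_of_unitary hU i j

/-- A form in `𝒰(ℂ³)` is bounded away from zero on unitary frames. -/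
theorem exists_lower_bound {Ω : (Fin 3 → ℂ) [⋀^Fin 3]→L[ℝ] ℂ}
    (hΩ : Ω ∈ formsU 3 (stdSymplecticForm 3)) :
    ∃ ε > 0, ∀ U ∈ Matrix.unitaryGroup (Fin 3) ℂ, ε ≤ ‖Ω (fun j => U j)‖ := by
  obtain ⟨U₀, hU₀, hmin⟩ := (isCompact_unitaryGroup 3).exists_isMinOn ⟨1, one_mem _⟩
    (f := fun U : Matrix (Fin 3) (Fin 3) ℂ => ‖Ω (fun j => U j)‖)
    (Ω.cont.norm.continuousOn)
  exact ⟨_, norm_pos_iff.mpr ((mem_formsU_iff.mp hΩ).2 U₀ hU₀), fun U hU => hmin hU⟩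

/-- Small multiples of `dz₁₂₃` and of its conjugate can be added inside `𝒰⁺(ℂ³)`. -/
theorem exists_perturbation {Ω : (Fin 3 → ℂ) [⋀^Fin 3]→L[ℝ] ℂ}
    (hΩ : Ω ∈ formsUPlus 3 (stdSymplecticForm 3)) :
    ∃ ε > 0, ∀ η : ℂ, ‖η‖ ≤ ε → Ω + η • holVol ∈ formsUPlus 3 (stdSymplecticForm 3) ∧
      Ω + η • conjForm holVol ∈ formsUPlus 3 (stdSymplecticForm 3) := by
  obtain ⟨ε, hε, hlow⟩ := exists_lower_bound (formsUPlus_subset hΩ)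
  have hw : wedgeForms holVol (stdSymplecticForm 3) = 0 := by
    rw [holVol_eq_normalForm]; exact wedgeForms_normalForm _ _ _
  have main : ∀ Ω' : (Fin 3 → ℂ) [⋀^Fin 3]→L[ℝ] ℂ, wedgeForms Ω' (stdSymplecticForm 3) = 0 →
      (∀ U ∈ Matrix.unitaryGroup (Fin 3) ℂ, ‖Ω' (fun j => U j)‖ = 1) →
      ∀ η : ℂ, ‖η‖ ≤ ε / 2 → Ω + η • Ω' ∈ formsUPlus 3 (stdSymplecticForm 3) := by
    intro Ω' hw' h1 η hη
    refine formsUPlus_of_segment hΩ fun t ht0 ht1 => ?_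
    rw [smul_smul]
    refine mem_formsU_iff.mpr ⟨wedgeForms_add_smul (formsUPlus_subset hΩ).1 hw' _, ?_⟩
    intro U hU h0
    have h2 : Ω (fun j => U j) = -((t * η) * Ω' (fun j => U j)) := by
      rw [ContinuousAlternatingMap.add_apply, ContinuousAlternatingMap.smul_apply,
        smul_eq_mul] at h0
      linear_combination h0
    have h3 := hlow U hU
    rw [h2, norm_neg, norm_mul, h1 U hU, norm_mul, Complex.norm_real, Real.norm_of_nonneg ht0] at h3
    nlinarith [norm_nonneg η]
  refine ⟨ε / 2, by positivity, fun η hη => ⟨main _ hw ?_ η hη,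
    main _ (wedgeForms_conjForm hw) ?_ η hη⟩⟩
  · intro U hU
    rw [holVol_apply]
    exact norm_det_of_unitary hU
  · intro U hU
    rw [conjForm_apply, RCLike.norm_conj, holVol_apply]
    exact norm_det_of_unitary hU

/-- Equality in the triangle inequality after a rotation of the second summand. -/
theorem exists_norm_add_mul_eq (x y : ℂ) : ∃ ζ : ℂ, ‖ζ‖ = 1 ∧ ‖x + ζ * y‖ = ‖x‖ + ‖y‖ := by
  by_cases hx : x = 0
  · exact ⟨1, by simp, by simp [hx]⟩
  by_cases hy : y = 0
  · exact ⟨1, by simp, by simp [hy]⟩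
  have hx' : (‖x‖ : ℂ) ≠ 0 := by simpa using hx
  have hy' : (‖y‖ : ℂ) ≠ 0 := by simpa using hy
  refine ⟨x / ‖x‖ * (‖y‖ / y), ?_, ?_⟩
  · have hx'' : ‖x‖ ≠ 0 := by simpa using hx
    have hy'' : ‖y‖ ≠ 0 := by simpa using hy
    simp only [norm_mul, norm_div, Complex.norm_real, norm_norm]
    field_simp
  · have e : x + x / ‖x‖ * (‖y‖ / y) * y = x / ‖x‖ * ((‖x‖ + ‖y‖ : ℝ) : ℂ) := by
      push_cast
      field_simp
    rw [e, norm_mul, norm_div, Complex.norm_real, Complex.norm_real, norm_norm,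
      div_self (by simpa using hx), one_mul, Real.norm_of_nonneg (by positivity)]

/-- The function `|a|² - |b|²` of the coefficients `a` of `dz₁₂₃` and `b` of `dz̄₁₂₃` in a form. -/
def gap (Ω : (Fin 3 → ℂ) [⋀^Fin 3]→L[ℝ] ℂ) : ℝ := ‖coeffA Ω‖ ^ 2 - ‖coeffB Ω‖ ^ 2

theorem add_smul_comp (Ω Ω' : (Fin 3 → ℂ) [⋀^Fin 3]→L[ℝ] ℂ) (c : ℂ)
    (g : (Fin 3 → ℂ) →L[ℝ] (Fin 3 → ℂ)) :
    (Ω + c • Ω').compContinuousLinearMap g =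
      Ω.compContinuousLinearMap g + c • Ω'.compContinuousLinearMap g := rfl

theorem conjForm_comp (Ω : (Fin 3 → ℂ) [⋀^Fin 3]→L[ℝ] ℂ)
    (g : (Fin 3 → ℂ) →L[ℝ] (Fin 3 → ℂ)) :
    (conjForm Ω).compContinuousLinearMap g = conjForm (Ω.compContinuousLinearMap g) := rfl

/-- Along the symplectic group, the gap of a form in `𝒰⁺(ℂ³)` is bounded below by a multiple of that
of `dz₁₂₃`: apply the domination `|b| < |a|` to the perturbed forms with well chosen phases. -/
theorem exists_gap_lower_bound {Ω : (Fin 3 → ℂ) [⋀^Fin 3]→L[ℝ] ℂ}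
    (hΩ : Ω ∈ formsUPlus 3 (stdSymplecticForm 3)) :
    ∃ κ > 0, ∀ g ∈ symplecticAut (stdSymplecticForm 3),
      κ * gap (holVol.compContinuousLinearMap (g : (Fin 3 → ℂ) →L[ℝ] (Fin 3 → ℂ))) ≤
        gap (Ω.compContinuousLinearMap (g : (Fin 3 → ℂ) →L[ℝ] (Fin 3 → ℂ))) := by
  obtain ⟨ε, hε, hper⟩ := exists_perturbation hΩ
  refine ⟨ε ^ 2 / 2, by positivity, fun g hg => ?_⟩
  set a := coeffA (Ω.compContinuousLinearMap (g : (Fin 3 → ℂ) →L[ℝ] (Fin 3 → ℂ))) with ha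
  set b := coeffB (Ω.compContinuousLinearMap (g : (Fin 3 → ℂ) →L[ℝ] (Fin 3 → ℂ))) with hb
  set a' := coeffA (holVol.compContinuousLinearMap (g : (Fin 3 → ℂ) →L[ℝ] (Fin 3 → ℂ))) with ha'
  set b' := coeffB (holVol.compContinuousLinearMap (g : (Fin 3 → ℂ) →L[ℝ] (Fin 3 → ℂ))) with hb'
  have h1 : ∀ η : ℂ, ‖η‖ ≤ ε → ‖b + η * b'‖ < ‖a + η * a'‖ := by
    intro η hη
    have := norm_coeffB_lt_norm_coeffA (formsUPlus_comp hg (hper η hη).1)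
    rwa [add_smul_comp, coeffA_add_smul, coeffB_add_smul] at this
  have h2 : ∀ η : ℂ, ‖η‖ ≤ ε → ‖b + η * (starRingEnd ℂ) a'‖ < ‖a + η * (starRingEnd ℂ) b'‖ := by
    intro η hη
    have := norm_coeffB_lt_norm_coeffA (formsUPlus_comp hg (hper η hη).2)
    rwa [add_smul_comp, coeffA_add_smul, coeffB_add_smul, conjForm_comp, coeffA_conjForm,
      coeffB_conjForm] at this
  -- otherwise `a + η a'` would vanish for some small `η`
  have h3 : ε * ‖a'‖ ≤ ‖a‖ := by
    by_contra! hlt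
    have ha0 : a' ≠ 0 := by
      rintro h0
      rw [h0, norm_zero, mul_zero] at hlt
      exact absurd hlt (not_lt.mpr (norm_nonneg a))
    have := h1 (-a / a') (by
      rw [norm_div, norm_neg, div_le_iff₀ (norm_pos_iff.mpr ha0)]; exact hlt.le)
    rw [div_mul_cancel₀ _ ha0, add_neg_cancel, norm_zero] at this
    exact absurd this (not_lt.mpr (norm_nonneg _))
  -- the perturbation by the conjugate of `dz₁₂₃`, with the phase for which it increases `|b|` most
  have h4 : ε * (‖a'‖ - ‖b'‖) ≤ ‖a‖ - ‖b‖ := by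
    obtain ⟨ζ, hζ, he⟩ := exists_norm_add_mul_eq b (ε * (starRingEnd ℂ) a')
    have hn : ‖ζ * ε‖ = ε := by
      rw [norm_mul, hζ, one_mul, Complex.norm_real, Real.norm_of_nonneg hε.le]
    have := h2 (ζ * ε) hn.le
    rw [mul_assoc ζ _ ((starRingEnd ℂ) a'), he, norm_mul, RCLike.norm_conj, Complex.norm_real,
      Real.norm_of_nonneg hε.le] at this
    have h5 := norm_add_le a (ζ * ε * (starRingEnd ℂ) b')
    rw [norm_mul, hn, RCLike.norm_conj] at h5
    linarith
  have h6 : ‖b‖ < ‖a‖ := by simpa using h1 0 (by simpa using hε.le)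
  rw [gap, gap, ← ha, ← hb, ← ha', ← hb']
  rcases le_or_gt ‖a'‖ ‖b'‖ with h7 | h7
  · have : ‖a'‖ ^ 2 ≤ ‖b'‖ ^ 2 := by gcongr
    have : ‖b‖ ^ 2 ≤ ‖a‖ ^ 2 := by gcongr
    nlinarith [sq_nonneg ε]
  · have h8 : (ε * (‖a'‖ - ‖b'‖)) * (ε * ‖a'‖) ≤ (‖a‖ - ‖b‖) * ‖a‖ :=
      mul_le_mul h4 h3 (by positivity) (by linarith)
    have h9 : (‖a'‖ - ‖b'‖) * (‖a'‖ + ‖b'‖) ≤ (‖a'‖ - ‖b'‖) * (2 * ‖a'‖) :=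
      mul_le_mul_of_nonneg_left (by linarith) (by linarith)
    nlinarith [norm_nonneg b, sq_nonneg ε, mul_le_mul_of_nonneg_left h9 (sq_nonneg ε),
      mul_nonneg (sub_nonneg.mpr h6.le) (norm_nonneg b)]

end Perturbation

/-! ### Existence of a minimizer of the gap -/

section Coercivity
open Complex Matrix
open scoped ComplexOrder

/-- The complex linear part of a real linear endomorphism of `ℂ³`, as a matrix. -/
def linPart (g : (Fin 3 → ℂ) →L[ℝ] (Fin 3 → ℂ)) : Matrix (Fin 3) (Fin 3) ℂ :=
  Matrix.of fun i j => (g (Pi.single j 1) i - I * g (Pi.single j I) i) / 2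

/-- The complex antilinear part of a real linear endomorphism of `ℂ³`: the matrix `B` such that the
antilinear part is `v ↦ B v̄`. -/
def antiPart (g : (Fin 3 → ℂ) →L[ℝ] (Fin 3 → ℂ)) : Matrix (Fin 3) (Fin 3) ℂ :=
  Matrix.of fun i j => (g (Pi.single j 1) i + I * g (Pi.single j I) i) / 2

theorem apply_eq_linPart_add_antiPart (g : (Fin 3 → ℂ) →L[ℝ] (Fin 3 → ℂ)) (v : Fin 3 → ℂ)
    (i : Fin 3) :
    g v i = ∑ j, (linPart g i j * v j + antiPart g i j * (starRingEnd ℂ) (v j)) := by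
  have hv : v = ∑ k, ((v k).re • (Pi.single k 1 : Fin 3 → ℂ) +
      (v k).im • (Pi.single k I : Fin 3 → ℂ)) := by
    ext i
    simp [Finset.sum_apply, Pi.single_apply, Finset.sum_add_distrib, Complex.re_add_im]
  conv_lhs => rw [hv]
  rw [map_sum, Finset.sum_apply]
  refine Finset.sum_congr rfl fun j _ => ?_
  rw [map_add, map_smul, map_smul, Pi.add_apply, Pi.smul_apply, Pi.smul_apply, Complex.real_smul,
    Complex.real_smul]
  have h1 : v j = (v j).re + (v j).im * I := (Complex.re_add_im _).symm
  have h2 : (starRingEnd ℂ) (v j) = (v j).re - (v j).im * I := by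
    apply Complex.ext <;> simp
  rw [h2]
  simp only [linPart, antiPart, Matrix.of_apply]
  linear_combination (-((g (Pi.single j 1) i - I * g (Pi.single j I) i) / 2)) * h1
    + (((v j).im : ℂ) * g (Pi.single j I) i) * I_sq

theorem coeffA_holVol_comp (g : (Fin 3 → ℂ) →L[ℝ] (Fin 3 → ℂ)) :
    coeffA (holVol.compContinuousLinearMap g) = (linPart g).det := by
  simp only [coeffA, typeCoeff, compContinuousLinearMap_three_apply, holVol,
    wedgeCovectors_three_apply, dz, ContinuousLinearMap.proj_apply, Matrix.det_fin_three, linPart,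
    Matrix.of_apply]
  ring

theorem coeffB_holVol_comp (g : (Fin 3 → ℂ) →L[ℝ] (Fin 3 → ℂ)) :
    coeffB (holVol.compContinuousLinearMap g) = (antiPart g).det := by
  simp only [coeffB, typeCoeff, compContinuousLinearMap_three_apply, holVol,
    wedgeCovectors_three_apply, dz, ContinuousLinearMap.proj_apply, Matrix.det_fin_three, antiPart,
    Matrix.of_apply]
  ring

/-- For a symplectic map with complex linear part `A` and antilinear part `B`,
`A* A = 1 + (B* B)ᵀ`. -/
theorem linPart_conjTranspose_mul {g : (Fin 3 → ℂ) →L[ℝ] (Fin 3 → ℂ)}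
    (hg : ∀ u v, stdSymplecticForm 3 ![g u, g v] = stdSymplecticForm 3 ![u, v]) :
    (linPart g)ᴴ * linPart g = 1 + ((antiPart g)ᴴ * antiPart g)ᵀ := by
  have hω : ∀ u v : Fin 3 → ℂ, ∑ i, ((starRingEnd ℂ) (u i) * v i - (starRingEnd ℂ) (v i) * u i) =
      2 * I * (stdSymplecticForm 3 ![u, v] : ℝ) := by
    intro u v
    rw [stdSymplecticForm_apply, Complex.ofReal_sum, Finset.mul_sum]
    refine Finset.sum_congr rfl fun i _ => ?_
    apply Complex.ext
    · simp
      ring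
    · simp
      ring
  ext j k
  have k11 := hω (g (Pi.single j 1)) (g (Pi.single k 1))
  have kII := hω (g (Pi.single j I)) (g (Pi.single k I))
  have k1I := hω (g (Pi.single j 1)) (g (Pi.single k I))
  have kI1 := hω (g (Pi.single j I)) (g (Pi.single k 1))
  have r11 : stdSymplecticForm 3 ![Pi.single j 1, Pi.single k 1] = 0 := by
    simp only [stdSymplecticForm_apply, Fin.sum_univ_three]
    fin_cases j <;> fin_cases k <;> simp
  have rII : stdSymplecticForm 3 ![Pi.single j I, Pi.single k I] = 0 := by
    simp only [stdSymplecticForm_apply, Fin.sum_univ_three]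
    fin_cases j <;> fin_cases k <;> simp
  have r1I : ((stdSymplecticForm 3 ![Pi.single j 1, Pi.single k I] : ℝ) : ℂ) =
      (1 : Matrix (Fin 3) (Fin 3) ℂ) j k := by
    simp only [stdSymplecticForm_apply, Fin.sum_univ_three]
    fin_cases j <;> fin_cases k <;> simp
  have rI1 : ((stdSymplecticForm 3 ![Pi.single j I, Pi.single k 1] : ℝ) : ℂ) =
      -(1 : Matrix (Fin 3) (Fin 3) ℂ) j k := by
    simp only [stdSymplecticForm_apply, Fin.sum_univ_three]
    fin_cases j <;> fin_cases k <;> simp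
  rw [hg, r11] at k11
  rw [hg, rII] at kII
  rw [hg, r1I] at k1I
  rw [hg, rI1] at kI1
  simp only [Fin.sum_univ_three] at k11 kII k1I kI1
  simp only [Matrix.add_apply, Matrix.transpose_apply, Matrix.mul_apply, Fin.sum_univ_three,
    Matrix.conjTranspose_apply, linPart, antiPart, Matrix.of_apply, star_div₀, star_add, star_sub,
    star_mul', Complex.star_def, Complex.conj_I, map_ofNat]
  generalize (1 : Matrix (Fin 3) (Fin 3) ℂ) j k = δ at *
  push_cast at k11 kII
  linear_combination (1 / 4) * (k11 + kII + I * kI1 - I * k1I)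
    + (((starRingEnd ℂ) (g (Pi.single k I) 0) * g (Pi.single j I) 0
      + (starRingEnd ℂ) (g (Pi.single k I) 1) * g (Pi.single j I) 1
      + (starRingEnd ℂ) (g (Pi.single k I) 2) * g (Pi.single j I) 2
      - (starRingEnd ℂ) (g (Pi.single j I) 0) * g (Pi.single k I) 0
      - (starRingEnd ℂ) (g (Pi.single j I) 1) * g (Pi.single k I) 1
      - (starRingEnd ℂ) (g (Pi.single j I) 2) * g (Pi.single k I) 2) / 4 - δ) * I_sq

/-- With `N = B* B` the gap of `dz₁₂₃` is `det (1 + N) - det N`, which is at least `1 + tr N`,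
because the principal minors of `N` are nonnegative. -/
theorem one_add_le_gap_holVol {g : (Fin 3 → ℂ) →L[ℝ] (Fin 3 → ℂ)}
    (hg : ∀ u v, stdSymplecticForm 3 ![g u, g v] = stdSymplecticForm 3 ![u, v]) :
    1 + ∑ i, ∑ j, ‖antiPart g i j‖ ^ 2 ≤ gap (holVol.compContinuousLinearMap g) := by
  rw [gap, coeffA_holVol_comp, coeffB_holVol_comp]
  set A := linPart g
  set B := antiPart g
  have hpsd : (Bᴴ * B).PosSemidef := Matrix.posSemidef_conjTranspose_mul_self B
  have hsq : ∀ M : Matrix (Fin 3) (Fin 3) ℂ, ‖M.det‖ ^ 2 = ((Mᴴ * M).det).re := by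
    intro M
    rw [Matrix.det_mul, Matrix.det_conjTranspose, ← Complex.normSq_eq_norm_sq]
    simp [Complex.normSq_apply]
  have htr : (∑ i, ∑ j, ‖B i j‖ ^ 2) = ((Bᴴ * B).trace).re := by
    rw [Finset.sum_comm, Matrix.trace, Complex.re_sum]
    refine Finset.sum_congr rfl fun j _ => ?_
    rw [Matrix.diag_apply, Matrix.mul_apply, Complex.re_sum]
    refine Finset.sum_congr rfl fun i _ => ?_
    rw [← Complex.normSq_eq_norm_sq]
    simp [Matrix.conjTranspose_apply, Complex.normSq_apply]
  rw [hsq, hsq, linPart_conjTranspose_mul hg, ← Matrix.transpose_one, ← Matrix.transpose_add,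
    Matrix.det_transpose, htr]
  set N := Bᴴ * B
  have minor : ∀ f : Fin 2 → Fin 3, 0 ≤ ((N.submatrix f f).det).re := fun f =>
    (Complex.le_def.mp (hpsd.submatrix f).det_nonneg).1
  have m01 := minor ![0, 1]
  have m02 := minor ![0, 2]
  have m12 := minor ![1, 2]
  rw [Matrix.det_fin_two] at m01 m02 m12
  simp only [Matrix.submatrix_apply, Matrix.cons_val_zero, Matrix.cons_val_one] at m01 m02 m12
  have e : (1 + N).det = 1 + N.trace + (N 0 0 * N 1 1 - N 0 1 * N 1 0)
      + (N 0 0 * N 2 2 - N 0 2 * N 2 0) + (N 1 1 * N 2 2 - N 1 2 * N 2 1) + N.det := by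
    rw [Matrix.det_fin_three, Matrix.det_fin_three, Matrix.trace_fin_three]
    simp [Matrix.add_apply]
    ring
  rw [e]
  simp only [Complex.add_re, Complex.one_re]
  linarith

theorem norm_sq_linPart_le {g : (Fin 3 → ℂ) →L[ℝ] (Fin 3 → ℂ)}
    (hg : ∀ u v, stdSymplecticForm 3 ![g u, g v] = stdSymplecticForm 3 ![u, v]) (i j : Fin 3) :
    ‖linPart g i j‖ ^ 2 ≤ 1 + ∑ i, ∑ j, ‖antiPart g i j‖ ^ 2 := by
  have h := congrArg Complex.re (congrFun (congrFun (linPart_conjTranspose_mul hg) j) j)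
  rw [Matrix.add_apply, Matrix.transpose_apply, Matrix.mul_apply, Matrix.mul_apply,
    Matrix.one_apply_eq, Complex.add_re, Complex.re_sum, Complex.re_sum, Complex.one_re] at h
  have e : ∀ (M : Matrix (Fin 3) (Fin 3) ℂ) (i : Fin 3), (Mᴴ j i * M i j).re = ‖M i j‖ ^ 2 := by
    intro M i
    rw [← Complex.normSq_eq_norm_sq]
    simp [Matrix.conjTranspose_apply, Complex.normSq_apply]
  simp only [e] at h
  calc ‖linPart g i j‖ ^ 2 ≤ ∑ i, ‖linPart g i j‖ ^ 2 :=
        Finset.single_le_sum (f := fun i => ‖linPart g i j‖ ^ 2) (fun _ _ => by positivity)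
          (Finset.mem_univ i)
    _ = 1 + ∑ i, ‖antiPart g i j‖ ^ 2 := h
    _ ≤ _ := by
      gcongr with i
      exact Finset.single_le_sum (f := fun j => ‖antiPart g i j‖ ^ 2) (fun _ _ => by positivity)
          (Finset.mem_univ j)

theorem norm_sq_entry_le (M : Matrix (Fin 3) (Fin 3) ℂ) (i j : Fin 3) :
    ‖M i j‖ ^ 2 ≤ ∑ i, ∑ j, ‖M i j‖ ^ 2 :=
  (Finset.single_le_sum (f := fun j => ‖M i j‖ ^ 2) (fun _ _ => by positivity)
    (Finset.mem_univ j)).trans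
  (Finset.single_le_sum (f := fun i => ∑ j, ‖M i j‖ ^ 2)
    (fun _ _ => by positivity) (Finset.mem_univ i))

theorem opNorm_le_of_parts {g : (Fin 3 → ℂ) →L[ℝ] (Fin 3 → ℂ)} {R : ℝ} (hR : 0 ≤ R)
    (hA : ∀ i j, ‖linPart g i j‖ ≤ R) (hB : ∀ i j, ‖antiPart g i j‖ ≤ R) : ‖g‖ ≤ 6 * R := by
  refine g.opNorm_le_bound (by positivity) fun v => ?_
  rw [pi_norm_le_iff_of_nonneg (by positivity)]
  intro i
  rw [apply_eq_linPart_add_antiPart]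
  calc ‖∑ j, (linPart g i j * v j + antiPart g i j * (starRingEnd ℂ) (v j))‖
      ≤ ∑ j : Fin 3, (R * ‖v‖ + R * ‖v‖) := by
        refine norm_sum_le_of_le _ fun j _ => (norm_add_le _ _).trans ?_
        rw [norm_mul, norm_mul, RCLike.norm_conj]
        have := norm_le_pi_norm v j
        have := hA i j
        have := hB i j
        gcongr
    _ = 6 * R * ‖v‖ := by simp; ring

/-- The gap of `dz₁₂₃` is a proper function on the symplectic group. -/
theorem opNorm_le_gap_holVol {g : (Fin 3 → ℂ) →L[ℝ] (Fin 3 → ℂ)}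
    (hg : ∀ u v, stdSymplecticForm 3 ![g u, g v] = stdSymplecticForm 3 ![u, v]) :
    ‖g‖ ≤ 6 * (1 + gap (holVol.compContinuousLinearMap g)) := by
  have h1 := one_add_le_gap_holVol hg
  generalize gap (holVol.compContinuousLinearMap g) = Γ at h1 ⊢
  have h2 : 0 ≤ ∑ i, ∑ j, ‖antiPart g i j‖ ^ 2 :=
    Finset.sum_nonneg fun _ _ => Finset.sum_nonneg fun _ _ => sq_nonneg _
  have hle : ∀ x : ℝ, x ^ 2 ≤ Γ → x ≤ 1 + Γ := fun x h => by nlinarith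
  refine opNorm_le_of_parts (by linarith) (fun i j => hle _ ?_) (fun i j => hle _ ?_)
  · exact (norm_sq_linPart_le hg i j).trans h1
  · exact (norm_sq_entry_le _ i j).trans (by linarith)

/-- A real linear endomorphism preserving the symplectic form is a symplectic automorphism. -/
theorem exists_symplecticAut {g : (Fin 3 → ℂ) →L[ℝ] (Fin 3 → ℂ)}
    (hg : ∀ u v, stdSymplecticForm 3 ![g u, g v] = stdSymplecticForm 3 ![u, v]) :
    ∃ h ∈ symplecticAut (stdSymplecticForm 3), (h : (Fin 3 → ℂ) →L[ℝ] (Fin 3 → ℂ)) = g := by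
  have hinj : Function.Injective (g : (Fin 3 → ℂ) →ₗ[ℝ] (Fin 3 → ℂ)) := by
    rw [injective_iff_map_eq_zero]
    intro v hv
    have h0 : ∀ w, stdSymplecticForm 3 ![v, w] = 0 := by
      intro w
      rw [← hg]
      have : g v = 0 := hv
      rw [this, stdSymplecticForm_apply]
      simp
    funext j
    have h1 := h0 (Pi.single j 1)
    have h2 := h0 (Pi.single j I)
    rw [stdSymplecticForm_apply, Finset.sum_eq_single j] at h1 h2
    · apply Complex.ext
      · simpa using h2
      · simpa using h1
    all_goals simp +contextual
  refine ⟨(LinearEquiv.ofInjectiveEndo _ hinj).toContinuousLinearEquiv, hg, ?_⟩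
  ext v
  rfl

theorem continuous_gap_comp (Ω : (Fin 3 → ℂ) [⋀^Fin 3]→L[ℝ] ℂ) :
    Continuous fun g : (Fin 3 → ℂ) →L[ℝ] (Fin 3 → ℂ) => gap (Ω.compContinuousLinearMap g) := by
  have h : ∀ x y z : Fin 3 → ℂ, Continuous fun g : (Fin 3 → ℂ) →L[ℝ] (Fin 3 → ℂ) =>
      (Ω.compContinuousLinearMap g) ![x, y, z] := by
    intro x y z
    refine Ω.cont.comp (continuous_pi fun i => ?_)
    exact continuous_eval_const (![x, y, z] i)
  simp only [gap, coeffA, coeffB, typeCoeff]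
  fun_prop

/-- The gap attains its minimum on the symplectic orbit of a form in `𝒰⁺(ℂ³)`. -/
theorem exists_gap_minimizer {Ω : (Fin 3 → ℂ) [⋀^Fin 3]→L[ℝ] ℂ}
    (hΩ : Ω ∈ formsUPlus 3 (stdSymplecticForm 3)) :
    ∃ g ∈ symplecticAut (stdSymplecticForm 3), ∀ h : (Fin 3 → ℂ) →L[ℝ] (Fin 3 → ℂ),
      (∀ u v, stdSymplecticForm 3 ![h u, h v] = stdSymplecticForm 3 ![u, v]) →
      gap (Ω.compContinuousLinearMap (g : (Fin 3 → ℂ) →L[ℝ] (Fin 3 → ℂ))) ≤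
        gap (Ω.compContinuousLinearMap h) := by
  obtain ⟨κ, hκ, hlow⟩ := exists_gap_lower_bound hΩ
  set Sp : Set ((Fin 3 → ℂ) →L[ℝ] (Fin 3 → ℂ)) :=
    {h | ∀ u v, stdSymplecticForm 3 ![h u, h v] = stdSymplecticForm 3 ![u, v]} with hSp
  set Γ := gap (Ω.compContinuousLinearMap (ContinuousLinearMap.id ℝ (Fin 3 → ℂ))) with hΓ
  set K := Sp ∩ {h | gap (Ω.compContinuousLinearMap h) ≤ Γ} with hK
  have hclosed : IsClosed K := by
    refine IsClosed.inter ?_ (isClosed_le (continuous_gap_comp Ω) continuous_const)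
    simp only [hSp, Set.ofPred_forall]
    refine isClosed_iInter fun u => isClosed_iInter fun v => isClosed_eq ?_ continuous_const
    simp only [stdSymplecticForm_apply]
    have : ∀ (u : Fin 3 → ℂ) (j : Fin 3),
        Continuous fun h : (Fin 3 → ℂ) →L[ℝ] (Fin 3 → ℂ) => h u j := fun u j =>
      (continuous_apply j).comp (continuous_eval_const u)
    fun_prop
  have hbdd : Bornology.IsBounded K := by
    refine (Metric.isBounded_closedBall (x := 0) (r := 6 * (1 + Γ / κ))).subset ?_
    rintro h ⟨hh, hle⟩
    rw [mem_closedBall_zero_iff]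
    obtain ⟨h', hh', rfl⟩ := exists_symplecticAut hh
    refine (opNorm_le_gap_holVol hh).trans ?_
    gcongr
    rw [le_div_iff₀ hκ, mul_comm]
    exact (hlow h' hh').trans hle
  obtain ⟨g, ⟨hg, hgΓ⟩, hmin⟩ :=
    (Metric.isCompact_of_isClosed_isBounded hclosed hbdd).exists_isMinOn
      ⟨ContinuousLinearMap.id ℝ _, fun _ _ => rfl, le_refl Γ⟩ (continuous_gap_comp Ω).continuousOn
  obtain ⟨g', hg', rfl⟩ := exists_symplecticAut hg
  refine ⟨g', hg', fun h hh => ?_⟩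
  rcases le_or_gt (gap (Ω.compContinuousLinearMap h)) Γ with hle | hgt
  · exact hmin ⟨hh, hle⟩
  · exact le_trans hgΓ hgt.le

end Coercivity

/-! ### Critical points of the gap -/

section Criticality
open Complex

/-- A first-order term dominated by a second-order term vanishes. -/
theorem eq_zero_of_forall_mul_le {X K : ℝ} (h : ∀ t : ℝ, 2 * t * X ≤ t ^ 2 * K) : X = 0 := by
  have hk : 0 < |K| + 1 := by positivity
  have h1 := h (X / (|K| + 1))
  have h2 : (X / (|K| + 1)) ^ 2 * K ≤ (X / (|K| + 1)) ^ 2 * (|K| + 1) := by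
    gcongr
    linarith [le_abs_self K]
  have h3 : 2 * (X / (|K| + 1)) * X = 2 * (X ^ 2 / (|K| + 1)) := by ring
  have h4 : (X / (|K| + 1)) ^ 2 * (|K| + 1) = X ^ 2 / (|K| + 1) := by field_simp
  have h5 : X ^ 2 / (|K| + 1) ≤ 0 := by linarith
  have h6 : X ^ 2 ≤ 0 := by
    by_contra! h7
    exact absurd h5 (not_le.mpr (by positivity))
  exact pow_eq_zero_iff two_ne_zero |>.mp (le_antisymm h6 (sq_nonneg X))

/-- A critical point of the gap at which the `(0, 3)`-part vanishes has no `(2, 1)`-part. It is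
enough to move along transvections. -/
theorem coeffT_eq_zero_of_minimal {Ω : (Fin 3 → ℂ) [⋀^Fin 3]→L[ℝ] ℂ}
    (hw : wedgeForms Ω (stdSymplecticForm 3) = 0) (hb : coeffB Ω = 0) (ha : coeffA Ω ≠ 0)
    (hmin : ∀ (u : Fin 3 → ℂ) (s : ℝ), gap Ω ≤
      gap (Ω.compContinuousLinearMap (transvection u s))) : coeffT Ω = 0 := by
  have hsymm : (coeffT Ω).IsSymm := by
    rw [eq_dolbeaultForm Ω] at hw
    exact (coeff_isSymm_of_primitive hw).2
  set T := coeffT Ω with hT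
  set Q : (Fin 3 → ℂ) → ℂ := fun u =>
    ∑ j, ∑ m, (starRingEnd ℂ) (u j) * T j m * (starRingEnd ℂ) (u m) with hQ
  -- the first variation of the gap along the transvections in the direction `u`
  have him : ∀ u, ((starRingEnd ℂ) (coeffA Ω) * Q u).im = 0 := by
    intro u
    obtain ⟨β, hβ⟩ := coeffB_comp_transvection Ω u
    set D : ℂ := I / 2 * (coeffA Ω * ∑ j, (starRingEnd ℂ) (u j) * u j + Q u) with hD
    have hA : ∀ s : ℝ, coeffA (Ω.compContinuousLinearMap (transvection u s)) =
        coeffA Ω - s * D := by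
      intro s
      have := coeffA_comp_transvection (coeffA Ω) (coeffB Ω) (coeffS Ω) (coeffT Ω) u s
      rwa [← eq_dolbeaultForm] at this
    have hX : ((starRingEnd ℂ) (coeffA Ω) * D).re = 0 := by
      refine eq_zero_of_forall_mul_le (K := ‖D‖ ^ 2) fun s => ?_
      have h := hmin u s
      rw [gap, gap, hA, hβ, hb, norm_zero, zero_add] at h
      have h1 : ‖coeffA Ω - s * D‖ ^ 2 = ‖coeffA Ω‖ ^ 2
          - 2 * s * ((starRingEnd ℂ) (coeffA Ω) * D).re + s ^ 2 * ‖D‖ ^ 2 := by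
        simp only [← Complex.normSq_eq_norm_sq, Complex.normSq_apply]
        simp
        ring
      nlinarith [sq_nonneg ‖(s : ℂ) * β‖]
    have hr : ∑ j, (starRingEnd ℂ) (u j) * u j = ((∑ j, Complex.normSq (u j) : ℝ) : ℂ) := by
      rw [Complex.ofReal_sum]
      exact Finset.sum_congr rfl fun j _ => Complex.normSq_eq_conj_mul_self.symm
    have e : (starRingEnd ℂ) (coeffA Ω) * D =
        I * ((Complex.normSq (coeffA Ω) * (∑ j, Complex.normSq (u j)) / 2 : ℝ) : ℂ)
          + I / 2 * ((starRingEnd ℂ) (coeffA Ω) * Q u) := by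
      push_cast
      rw [hD, hr, Complex.normSq_eq_conj_mul_self]
      push_cast
      ring
    rw [e, Complex.add_re, Complex.re_mul_ofReal, Complex.I_re, zero_mul, zero_add] at hX
    have e2 : (I / 2 * ((starRingEnd ℂ) (coeffA Ω) * Q u)).re =
        -((starRingEnd ℂ) (coeffA Ω) * Q u).im / 2 := by
      rw [show I / 2 = ((1 / 2 : ℝ) : ℂ) * I by push_cast; ring, mul_assoc, Complex.re_ofReal_mul,
        Complex.I_mul_re]
      ring
    linarith
  -- a unit multiple of `u` replaces `Q u` by `I * Q u`
  have hQ0 : ∀ u, Q u = 0 := by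
    intro u
    obtain ⟨ζ, -, hζ⟩ := exists_conj_sq_eq (w := I) (by simp)
    have h1 := him u
    have h2 := him (ζ • u)
    have e : Q (ζ • u) = I * Q u := by
      rw [← hζ, hQ]
      simp only [Finset.mul_sum, Pi.smul_apply, smul_eq_mul, map_mul]
      refine Finset.sum_congr rfl fun j _ => Finset.sum_congr rfl fun m _ => by ring
    rw [e, mul_left_comm, Complex.I_mul_im] at h2
    have h3 : (starRingEnd ℂ) (coeffA Ω) * Q u = 0 := Complex.ext h2 h1
    exact (mul_eq_zero.mp h3).resolve_left (by simpa using ha)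
  -- polarization
  have hdiag : ∀ j, T j j = 0 := by
    intro j
    have := hQ0 (Pi.single j 1)
    simpa [hQ, Pi.single_apply] using this
  ext j k
  have h1 := hQ0 (Pi.single j 1 + Pi.single k 1)
  have h2 := hdiag j
  have h3 := hdiag k
  have h4 := hsymm.apply j k
  simp [hQ, Pi.single_apply, add_mul, mul_add, Finset.sum_add_distrib, h2, h3, h4] at h1
  simpa using h1

end Criticality

/-! ### Takagi factorization -/

section Takagi
open Complex Matrix

/-- The plane rotation in the coordinates `i`, `j` with the block `(c, -s̄; s, c)`, where `c` is real
and `s` is complex. -/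
def givens (i j : Fin 3) (c : ℝ) (s : ℂ) : Matrix (Fin 3) (Fin 3) ℂ :=
  Matrix.of fun p q => if q = i then (if p = i then (c : ℂ) else if p = j then s else 0)
    else if q = j then (if p = j then (c : ℂ) else if p = i then -(starRingEnd ℂ) s else 0)
    else if p = q then 1 else 0

theorem givens_mem_unitaryGroup {i j : Fin 3} (hij : i ≠ j) {c : ℝ} {s : ℂ}
    (h : c ^ 2 + Complex.normSq s = 1) : givens i j c s ∈ Matrix.unitaryGroup (Fin 3) ℂ := by
  have h' : (c : ℂ) * c + s * (starRingEnd ℂ) s = 1 := by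
    rw [Complex.mul_conj, ← Complex.ofReal_one, ← h]; push_cast; ring
  rw [Matrix.mem_unitaryGroup_iff']
  ext p q
  rw [Matrix.mul_apply, Fin.sum_univ_three]
  simp only [Matrix.star_apply, givens, Matrix.of_apply]
  fin_cases i <;> fin_cases j <;> first
    | exact absurd rfl hij
    | (fin_cases p <;> fin_cases q <;> simp <;> first
        | done
        | linear_combination h'
        | ring1)

theorem trace_givens {i j : Fin 3} (hij : i ≠ j) (c : ℝ) (s : ℂ) (M : Matrix (Fin 3) (Fin 3) ℂ)
    (hM : M.IsSymm) (w : Fin 3 → ℂ) :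
    ∑ k, w k * ((givens i j c s)ᵀ * M * givens i j c s) k k = ∑ k, w k * M k k
      + w i * ((c ^ 2 - 1) * M i i + 2 * c * s * M i j + s ^ 2 * M j j)
      + w j * ((starRingEnd ℂ) s ^ 2 * M i i - 2 * c * (starRingEnd ℂ) s * M i j
        + (c ^ 2 - 1) * M j j) := by
  have h01 := hM.apply 0 1
  have h02 := hM.apply 0 2
  have h12 := hM.apply 1 2
  simp only [Matrix.mul_apply, Matrix.transpose_apply, Fin.sum_univ_three, givens, Matrix.of_apply]
  fin_cases i <;> fin_cases j <;> first
    | exact absurd rfl hij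
    | (simp [h01, h02, h12]; ring)

/-- Takagi factorization: a complex symmetric matrix is unitarily congruent to a nonnegative
diagonal matrix with increasing entries. The unitary matrix is found by maximizing the real part of
a weighted trace with increasing weights. -/
theorem exists_takagi {S : Matrix (Fin 3) (Fin 3) ℂ} (hS : S.IsSymm) :
    ∃ U ∈ Matrix.unitaryGroup (Fin 3) ℂ, ∃ γ : Fin 3 → ℝ, 0 ≤ γ 0 ∧ Monotone γ ∧
      Uᵀ * S * U = Matrix.diagonal fun k => (γ k : ℂ) := by
  set w : Fin 3 → ℝ := fun k => (k : ℝ) + 1 with hw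
  have hwpos : ∀ k, 0 < w k := fun k => by positivity
  obtain ⟨U, hU, hmax⟩ := (isCompact_unitaryGroup 3).exists_isMaxOn ⟨1, one_mem _⟩
    (f := fun U : Matrix (Fin 3) (Fin 3) ℂ => (∑ k, (w k : ℂ) * (Uᵀ * S * U) k k).re)
    (by fun_prop)
  set M := Uᵀ * S * U with hM
  have hMs : M.IsSymm := by
    rw [Matrix.IsSymm, hM, Matrix.transpose_mul, Matrix.transpose_mul, Matrix.transpose_transpose,
      hS.eq, Matrix.mul_assoc]
  have hG : ∀ G ∈ Matrix.unitaryGroup (Fin 3) ℂ, (∑ k, (w k : ℂ) * (Gᵀ * M * G) k k).re ≤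
      (∑ k, (w k : ℂ) * M k k).re := by
    intro G hG
    have := hmax (mul_mem hU hG)
    simp only [Set.mem_ofPred_eq, Matrix.transpose_mul] at this
    rw [hM]
    simpa only [Matrix.mul_assoc] using this
  -- maximality with respect to plane rotations
  have hgiv : ∀ i j, i ≠ j → ∀ (c : ℝ) (s : ℂ), c ^ 2 + Complex.normSq s = 1 →
      w i * ((c ^ 2 - 1) * (M i i).re + 2 * c * (s * M i j).re + (s ^ 2 * M j j).re)
      + w j * (((starRingEnd ℂ) s ^ 2 * M i i).re - 2 * c * ((starRingEnd ℂ) s * M i j).re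
        + (c ^ 2 - 1) * (M j j).re) ≤ 0 := by
    intro i j hij c s hcs
    have h := hG _ (givens_mem_unitaryGroup hij hcs)
    rw [trace_givens hij c s M hMs, add_assoc, Complex.add_re] at h
    have h2 := (add_le_iff_nonpos_right _).mp h
    refine le_of_eq_of_le ?_ h2
    have e : ((w i : ℂ) * ((c ^ 2 - 1) * M i i + 2 * c * s * M i j + s ^ 2 * M j j)
      + w j * ((starRingEnd ℂ) s ^ 2 * M i i - 2 * c * (starRingEnd ℂ) s * M i j
        + (c ^ 2 - 1) * M j j)) =
        ((w i : ℝ) : ℂ) * (((c ^ 2 - 1 : ℝ) : ℂ) * M i i + ((2 * c : ℝ) : ℂ) * (s * M i j)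
          + s ^ 2 * M j j)
        + ((w j : ℝ) : ℂ) * ((starRingEnd ℂ) s ^ 2 * M i i
          - ((2 * c : ℝ) : ℂ) * ((starRingEnd ℂ) s * M i j)
          + ((c ^ 2 - 1 : ℝ) : ℂ) * M j j) := by
      push_cast; ring
    rw [e]
    simp only [Complex.add_re, Complex.sub_re, Complex.re_ofReal_mul]
  -- the points `(c, s)` of the unit circle, parametrized by the slope
  have hcirc : ∀ t : ℝ, (1 / √(1 + t ^ 2)) ^ 2 + (t / √(1 + t ^ 2)) ^ 2 = 1 := by
    intro t
    rw [div_pow, div_pow, Real.sq_sqrt (by positivity)]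
    field_simp
  have hpara : ∀ X K : ℝ, (∀ c s : ℝ, c ^ 2 + s ^ 2 = 1 → 2 * c * s * X ≤ s ^ 2 * K) → X = 0 := by
    intro X K h
    refine eq_zero_of_forall_mul_le (K := K) fun t => ?_
    have h1 := h _ _ (hcirc t)
    have hp : 0 < √(1 + t ^ 2) := by positivity
    have e1 : 2 * (1 / √(1 + t ^ 2)) * (t / √(1 + t ^ 2)) * X =
        (2 * t * X) / √(1 + t ^ 2) ^ 2 := by field_simp
    have e2 : (t / √(1 + t ^ 2)) ^ 2 * K = (t ^ 2 * K) / √(1 + t ^ 2) ^ 2 := by field_simp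
    rw [e1, e2, div_le_div_iff_of_pos_right (by positivity)] at h1
    exact h1
  have hoff : ∀ i j, i ≠ j → M i j = 0 := by
    intro i j hij
    have hne : w i - w j ≠ 0 := by
      simp only [hw, add_sub_add_right_eq_sub, sub_ne_zero]
      exact_mod_cast fun h => hij (Fin.ext h)
    have hne' : w i + w j ≠ 0 := (add_pos (hwpos i) (hwpos j)).ne'
    -- rotations with real `s` control the real part, those with imaginary `s` the imaginary part;
    -- the weights have to be distinct for the former
    apply Complex.ext
    · have := hpara ((w i - w j) * (M i j).re) ((w i - w j) * ((M i i).re - (M j j).re))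
        fun c s hcs => by
          have h := hgiv i j hij c s (by rw [Complex.normSq_ofReal, ← pow_two]; exact hcs)
          have hc : c ^ 2 = 1 - s ^ 2 := by linarith
          rw [Complex.conj_ofReal, ← Complex.ofReal_pow] at h
          simp only [Complex.re_ofReal_mul] at h
          rw [hc] at h
          linarith
      exact (mul_eq_zero.mp this).resolve_left hne
    · have := hpara ((w i + w j) * -(M i j).im) ((w i + w j) * ((M i i).re + (M j j).re))
        fun c s hcs => by
          have h := hgiv i j hij c (s * I) (by
            rw [map_mul, Complex.normSq_ofReal, Complex.normSq_I, ← pow_two, mul_one]; exact hcs)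
          have hc : c ^ 2 = 1 - s ^ 2 := by linarith
          have e1 : ((s : ℂ) * I) ^ 2 = ((-s ^ 2 : ℝ) : ℂ) := by
            rw [mul_pow, I_sq]; push_cast; ring
          have e2 : (starRingEnd ℂ) ((s : ℂ) * I) = ((-s : ℝ) : ℂ) * I := by
            simp
          have e3 : (((-s : ℝ) : ℂ) * I) ^ 2 = ((-s ^ 2 : ℝ) : ℂ) := by
            rw [mul_pow, I_sq]; push_cast; ring
          rw [e2, e1, e3] at h
          simp only [mul_assoc, Complex.re_ofReal_mul, Complex.I_mul_re] at h
          rw [hc] at h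
          linarith
      have := (mul_eq_zero.mp this).resolve_left hne'
      simpa using this
  -- maximality with respect to diagonal matrices makes the diagonal nonnegative
  have hdiag : ∀ k, M k k = ((‖M k k‖ : ℝ) : ℂ) := by
    intro k
    by_cases h0 : M k k = 0
    · simp [h0]
    have hn : (‖M k k‖ : ℂ) ≠ 0 := by simpa using h0
    obtain ⟨ζ, hζ, hζ2⟩ := exists_conj_sq_eq (w := (starRingEnd ℂ) (M k k) / ‖M k k‖) (by
      rw [norm_div, RCLike.norm_conj, Complex.norm_real, norm_norm, div_self (by simpa using h0)])
    have hmem : Matrix.diagonal (Function.update (fun _ => (1 : ℂ)) k ((starRingEnd ℂ) ζ)) ∈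
        Matrix.unitaryGroup (Fin 3) ℂ := by
      refine diagonal_mem_unitaryGroup fun l => ?_
      by_cases hl : l = k
      · subst hl; simpa using hζ
      · simp [hl]
    have h := hG _ hmem
    rw [← Finset.add_sum_erase _ _ (Finset.mem_univ k),
      ← Finset.add_sum_erase _ _ (Finset.mem_univ k), Complex.add_re, Complex.add_re] at h
    have e : ∀ l ∈ Finset.univ.erase k, (w l : ℂ) *
        ((Matrix.diagonal (Function.update (fun _ => (1 : ℂ)) k ((starRingEnd ℂ) ζ)))ᵀ * M *
          Matrix.diagonal (Function.update (fun _ => (1 : ℂ)) k ((starRingEnd ℂ) ζ))) l l =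
        w l * M l l := by
      intro l hl
      rw [Matrix.diagonal_transpose, Matrix.mul_diagonal, Matrix.diagonal_mul,
        Function.update_of_ne (Finset.ne_of_mem_erase hl)]
      ring
    rw [Finset.sum_congr rfl e, add_le_add_iff_right, Matrix.diagonal_transpose,
      Matrix.mul_diagonal, Matrix.diagonal_mul, Function.update_self, Complex.re_ofReal_mul,
      Complex.re_ofReal_mul, mul_le_mul_iff_right₀ (hwpos k)] at h
    have e2 : (starRingEnd ℂ) ζ * M k k * (starRingEnd ℂ) ζ = (‖M k k‖ : ℝ) := by
      have : (starRingEnd ℂ) ζ * M k k * (starRingEnd ℂ) ζ =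
          (starRingEnd ℂ) ζ ^ 2 * M k k := by ring
      rw [this, hζ2, div_mul_eq_mul_div, ← Complex.normSq_eq_conj_mul_self,
        Complex.normSq_eq_norm_sq]
      push_cast
      field_simp
    rw [e2, Complex.ofReal_re] at h
    have h2 : (M k k).re = ‖M k k‖ := le_antisymm (Complex.re_le_norm _) h
    have h3 : (M k k).im = 0 := by
      have := Complex.sq_norm (M k k)
      rw [Complex.normSq_apply, ← h2] at this
      nlinarith
    apply Complex.ext
    · simpa using h2
    · simpa using h3
  refine ⟨U, hU, fun k => ‖M k k‖, norm_nonneg _, ?_, ?_⟩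
  · intro i j hij
    rcases hij.eq_or_lt with rfl | hlt
    · exact le_rfl
    -- the rotation which exchanges the two coordinates
    have h := hgiv i j hlt.ne 0 1 (by simp)
    rw [hdiag i, hdiag j] at h
    simp at h
    have : w i < w j := by
      simp only [hw, add_lt_add_iff_right]
      exact_mod_cast hlt
    change ‖M i i‖ ≤ ‖M j j‖
    nlinarith
  · ext i j
    by_cases hij : i = j
    · subst hij
      rw [Matrix.diagonal_apply_eq]
      exact hdiag i
    · rw [Matrix.diagonal_apply_ne _ hij]
      exact hoff i j hij

end Takagi

/-! ### Unitary changes of coordinates -/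

section UnitaryAction
open Complex Matrix

/-- The value of a form of type `(3, 0) + (1, 2)` in terms of cross products. -/
theorem dolbeaultForm_apply_cross (a : ℂ) (S : Matrix (Fin 3) (Fin 3) ℂ) (v : Fin 3 → Fin 3 → ℂ) :
    dolbeaultForm a 0 S 0 v = a * (Matrix.of v).det
      + (v 0 ⬝ᵥ S *ᵥ star (crossProduct (v 1) (v 2)) + v 1 ⬝ᵥ S *ᵥ star (crossProduct (v 2) (v 0))
        + v 2 ⬝ᵥ S *ᵥ star (crossProduct (v 0) (v 1))) := by
  have e : dolbeaultForm a 0 S 0 v = a * holVol v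
      + ∑ j, ∑ m, S j m * wedgeCovectors ![dz j, dzbar (m + 1), dzbar (m + 2)] v := by
    simp [dolbeaultForm, holVol, ContinuousAlternatingMap.sum_apply]
  have hv : v = ![v 0, v 1, v 2] := by funext i; fin_cases i <;> rfl
  rw [e, holVol_apply]
  congr 1
  rw [hv]
  simp only [wedgeCovectors_three_apply, dotProduct, mulVec, Fin.sum_univ_three, cross_apply,
    Pi.star_apply]
  simp [dz, dzbar]
  ring

theorem crossProduct_mulVec (U : Matrix (Fin 3) (Fin 3) ℂ) (v w : Fin 3 → ℂ) :
    crossProduct (U *ᵥ v) (U *ᵥ w) = U.adjugateᵀ *ᵥ crossProduct v w := by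
  rw [Matrix.adjugate_fin_three]
  ext i
  fin_cases i <;> simp [cross_apply, mulVec, dotProduct, Fin.sum_univ_three] <;> ring

theorem star_crossProduct_mulVec {U : Matrix (Fin 3) (Fin 3) ℂ}
    (hU : U ∈ Matrix.unitaryGroup (Fin 3) ℂ) (v w : Fin 3 → ℂ) :
    star (crossProduct (U *ᵥ v) (U *ᵥ w)) =
      (starRingEnd ℂ) U.det • U *ᵥ star (crossProduct v w) := by
  have h : U.adjugate = U.det • Uᴴ := by
    rw [← Matrix.mul_one U.adjugate, ← Matrix.mem_unitaryGroup_iff.mp hU, ← Matrix.mul_assoc,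
      Matrix.adjugate_mul, Matrix.smul_mul, Matrix.one_mul, Matrix.star_eq_conjTranspose]
  rw [crossProduct_mulVec, h, Matrix.star_mulVec, Matrix.transpose_smul, Matrix.conjTranspose_smul,
    Matrix.vecMul_smul]
  congr 1
  rw [← Matrix.mulVec_transpose]
  congr 1
  ext i j
  simp

/-- The pull-back of a form of type `(3, 0) + (1, 2)` under a unitary matrix. -/
theorem dolbeaultForm_mulVec (a : ℂ) (S : Matrix (Fin 3) (Fin 3) ℂ) {U : Matrix (Fin 3) (Fin 3) ℂ}
    (hU : U ∈ Matrix.unitaryGroup (Fin 3) ℂ) (v : Fin 3 → Fin 3 → ℂ) :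
    dolbeaultForm a 0 S 0 (fun k => U *ᵥ v k) =
      dolbeaultForm (a * U.det) 0 ((starRingEnd ℂ) U.det • (Uᵀ * S * U)) 0 v := by
  have hdet : (Matrix.of fun k => U *ᵥ v k).det = U.det * (Matrix.of v).det := by
    rw [← Matrix.det_transpose U, mul_comm, ← Matrix.det_mul]
    congr 1
    ext i j
    simp [Matrix.mul_apply, mulVec, dotProduct, mul_comm]
  have hterm : ∀ x y : Fin 3 → ℂ, (U *ᵥ x) ⬝ᵥ S *ᵥ ((starRingEnd ℂ) U.det • U *ᵥ y) =
      x ⬝ᵥ ((starRingEnd ℂ) U.det • (Uᵀ * S * U)) *ᵥ y := by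
    intro x y
    rw [Matrix.mulVec_smul, Matrix.smul_mulVec, dotProduct_smul, dotProduct_smul,
      ← Matrix.vecMul_transpose, ← Matrix.dotProduct_mulVec, Matrix.mulVec_mulVec,
      Matrix.mulVec_mulVec, Matrix.mul_assoc]
  rw [dolbeaultForm_apply_cross, dolbeaultForm_apply_cross, hdet]
  simp only [star_crossProduct_mulVec hU, hterm]
  ring

/-- A unitary matrix as a real linear endomorphism of `ℂ³`. -/
def unitaryCLM (U : Matrix (Fin 3) (Fin 3) ℂ) : (Fin 3 → ℂ) →L[ℝ] (Fin 3 → ℂ) :=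
  LinearMap.toContinuousLinearMap (U.mulVecLin.restrictScalars ℝ)

theorem unitaryCLM_apply (U : Matrix (Fin 3) (Fin 3) ℂ) (v : Fin 3 → ℂ) :
    unitaryCLM U v = U *ᵥ v := rfl

theorem unitaryCLM_symplectic {U : Matrix (Fin 3) (Fin 3) ℂ}
    (hU : U ∈ Matrix.unitaryGroup (Fin 3) ℂ) (u v : Fin 3 → ℂ) :
    stdSymplecticForm 3 ![unitaryCLM U u, unitaryCLM U v] = stdSymplecticForm 3 ![u, v] := by
  rw [stdSymplecticForm_eq_im, stdSymplecticForm_eq_im, unitaryCLM_apply, unitaryCLM_apply,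
    Matrix.star_mulVec, dotProduct_comm, ← Matrix.dotProduct_mulVec, Matrix.mulVec_mulVec,
    ← Matrix.star_eq_conjTranspose, Matrix.mem_unitaryGroup_iff'.mp hU, Matrix.one_mulVec,
    dotProduct_comm]

theorem dolbeaultForm_comp_unitaryCLM (a : ℂ) (S : Matrix (Fin 3) (Fin 3) ℂ)
    {U : Matrix (Fin 3) (Fin 3) ℂ} (hU : U ∈ Matrix.unitaryGroup (Fin 3) ℂ) :
    (dolbeaultForm a 0 S 0).compContinuousLinearMap (unitaryCLM U) =
      dolbeaultForm (a * U.det) 0 ((starRingEnd ℂ) U.det • (Uᵀ * S * U)) 0 := by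
  ext v
  rw [← dolbeaultForm_mulVec a S hU]
  generalize dolbeaultForm a 0 S 0 = Ω
  rfl

end UnitaryAction

/-! ### The normal forms belong to `𝒰⁺(ℂ³)` -/

section Converse
open Complex Matrix

theorem sum_norm_sq_row {U : Matrix (Fin 3) (Fin 3) ℂ}
    (hU : U ∈ Matrix.unitaryGroup (Fin 3) ℂ) (k : Fin 3) : ∑ j, ‖U j k‖ ^ 2 = 1 := by
  have h := congrFun (congrFun (Matrix.mem_unitaryGroup_iff'.mp hU) k) k
  rw [Matrix.mul_apply, Matrix.one_apply_eq] at h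
  have : ((∑ j, ‖U j k‖ ^ 2 : ℝ) : ℂ) = 1 := by
    rw [← h]
    push_cast
    refine Finset.sum_congr rfl fun j _ => ?_
    rw [Matrix.star_apply, RCLike.star_def, ← Complex.normSq_eq_conj_mul_self,
      Complex.normSq_eq_norm_sq]
    push_cast
    rfl
  exact_mod_cast this

/-- A normal form is nonzero on every Lagrangian subspace: on the rows of a unitary matrix `U`, the
holomorphic volume form has modulus one and the remaining terms have modulus at most
`γ₁ + γ₂ + γ₃`. -/
theorem normalForm_mem_formsU {γ₁ γ₂ γ₃ : ℝ} (h1 : 0 ≤ γ₁) (h2 : 0 ≤ γ₂) (h3 : 0 ≤ γ₃)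
    (h : γ₁ + γ₂ + γ₃ < 1) : normalForm γ₁ γ₂ γ₃ ∈ formsU 3 (stdSymplecticForm 3) := by
  refine mem_formsU_iff.mpr ⟨wedgeForms_normalForm _ _ _, fun U hU h0 => ?_⟩
  have hUt : Uᵀ ∈ Matrix.unitaryGroup (Fin 3) ℂ := by
    rw [Matrix.mem_unitaryGroup_iff', Matrix.star_eq_conjTranspose]
    have := congrArg Matrix.transpose (Matrix.mem_unitaryGroup_iff.mp hU)
    rwa [Matrix.transpose_mul, Matrix.transpose_one] at this
  -- the rows of `U` are the images of the standard basis under the transpose of `U`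
  have hrow : (fun j => U j) = fun j => Uᵀ *ᵥ (Pi.single j 1 : Fin 3 → ℂ) := by
    funext j i
    simp
  have hone : ∀ k : Fin 3, ‖(1 : Fin 3 → ℂ) k‖ = 1 := by simp
  have hframe := dolbeaultForm_diagonal_frame (1 * Uᵀ.det) 0
    ((starRingEnd ℂ) Uᵀ.det • (Uᵀᵀ * Matrix.diagonal ![(γ₁ : ℂ), γ₂, γ₃] * Uᵀ)) 0 hone
  rw [normalForm_eq_dolbeaultForm, hrow, dolbeaultForm_mulVec 1 _ hUt] at h0
  simp only [Pi.one_apply] at hframe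
  rw [hframe] at h0
  set σ : ℂ := ∑ j, (U * Matrix.diagonal ![(γ₁ : ℂ), γ₂, γ₃] * Uᵀ) j j with hσ
  have h0' : U.det = -((starRingEnd ℂ) U.det * σ) := by
    rw [hσ, Fin.sum_univ_three]
    simp [triaffine] at h0
    linear_combination h0
  have hσ1 : ‖σ‖ = 1 := by
    have := congrArg norm h0'
    rw [norm_neg, norm_mul, RCLike.norm_conj, norm_det_of_unitary hU, one_mul] at this
    exact this.symm
  have hσ2 : ‖σ‖ ≤ γ₁ + γ₂ + γ₃ := by
    have e : σ = ∑ j, ∑ k, ![(γ₁ : ℂ), γ₂, γ₃] k * U j k ^ 2 := by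
      refine Finset.sum_congr rfl fun j _ => ?_
      rw [Matrix.mul_apply]
      refine Finset.sum_congr rfl fun k _ => ?_
      rw [Matrix.mul_diagonal, Matrix.transpose_apply]
      ring
    rw [e, Finset.sum_comm]
    calc ‖∑ k, ∑ j, ![(γ₁ : ℂ), γ₂, γ₃] k * U j k ^ 2‖
        ≤ ∑ k, ‖![(γ₁ : ℂ), γ₂, γ₃] k‖ * ∑ j, ‖U j k‖ ^ 2 := by
          refine norm_sum_le_of_le _ fun k _ => ?_
          rw [← Finset.mul_sum, norm_mul]
          gcongr
          exact norm_sum_le_of_le _ fun j _ => (norm_pow _ _).le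
      _ = γ₁ + γ₂ + γ₃ := by
          simp only [sum_norm_sq_row hU, Fin.sum_univ_three, mul_one]
          simp [abs_of_nonneg, h1, h2, h3]
  linarith

/-- `dz₁₂₃` is of type `(3, 0)` for the multiplication by `I`. -/
theorem holVol_mem_formsUPlus : holVol ∈ formsUPlus 3 (stdSymplecticForm 3) := by
  have hmem : holVol ∈ formsU 3 (stdSymplecticForm 3) := by
    rw [holVol_eq_normalForm]
    exact normalForm_mem_formsU le_rfl le_rfl le_rfl (by norm_num)
  refine ⟨LinearMap.toContinuousLinearMap ((I : ℂ) • (LinearMap.id : (Fin 3 → ℂ) →ₗ[ℝ] _)),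
    ⟨fun v => ?_, fun u v => ?_, fun v hv => ?_⟩, holVol, hmem, fun v i => ?_,
    mem_connectedComponentIn hmem⟩
  · ext i
    simp [← mul_assoc]
  · rw [stdSymplecticForm_eq_im, stdSymplecticForm_eq_im]
    simp [star_smul, dotProduct_smul, smul_dotProduct, ← mul_assoc]
  · rw [stdSymplecticForm_eq_im, LinearMap.coe_toContinuousLinearMap', LinearMap.smul_apply,
      LinearMap.id_apply, smul_dotProduct, smul_eq_mul, Complex.I_mul_im, dotProduct,
      Complex.re_sum]
    obtain ⟨i, hi⟩ := Function.ne_iff.mp hv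
    have e : ∀ j, (v j * star v j).re = Complex.normSq (v j) := fun j => by
      rw [Pi.star_apply, RCLike.star_def, Complex.mul_conj, Complex.ofReal_re]
    simp only [e]
    exact Finset.sum_pos' (fun j _ => Complex.normSq_nonneg _)
      ⟨i, Finset.mem_univ _, Complex.normSq_pos.mpr hi⟩
  · rw [holVol_apply, holVol_apply]
    have := Matrix.det_updateRow_smul (Matrix.of v) i I (v i)
    have e : (Matrix.of v).updateRow i (v i) = Matrix.of v := Matrix.updateRow_eq_self _ i
    rw [e] at this
    exact this

theorem normalForm_mem_formsUPlus {γ₁ γ₂ γ₃ : ℝ} (h1 : 0 ≤ γ₁) (h2 : 0 ≤ γ₂) (h3 : 0 ≤ γ₃)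
    (h : γ₁ + γ₂ + γ₃ < 1) : normalForm γ₁ γ₂ γ₃ ∈ formsUPlus 3 (stdSymplecticForm 3) := by
  have e : normalForm γ₁ γ₂ γ₃ = holVol + (normalForm γ₁ γ₂ γ₃ - holVol) := by abel
  rw [e]
  refine formsUPlus_of_segment holVol_mem_formsUPlus fun t ht0 ht1 => ?_
  have e2 : holVol + (t : ℂ) • (normalForm γ₁ γ₂ γ₃ - holVol) =
      normalForm (t * γ₁) (t * γ₂) (t * γ₃) := by
    ext v
    simp [holVol, normalForm]
    ring
  rw [e2]
  refine normalForm_mem_formsU (by positivity) (by positivity) (by positivity) ?_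
  have : t * (γ₁ + γ₂ + γ₃) ≤ 1 * (γ₁ + γ₂ + γ₃) := by gcongr
  linarith

end Converse

/-! ### Reduction to normal form -/

section NormalForm
open Complex Matrix

/-- The transformation `z ↦ z + μ z̄` of the values, which is bijective and preserves the
orientation for `|μ| < 1`, preserves `𝒰⁺(ℂ³)`. -/
theorem add_smul_conjForm_mem {Ω : (Fin 3 → ℂ) [⋀^Fin 3]→L[ℝ] ℂ}
    (hΩ : Ω ∈ formsUPlus 3 (stdSymplecticForm 3)) {μ : ℂ} (hμ : ‖μ‖ < 1) :
    Ω + μ • conjForm Ω ∈ formsUPlus 3 (stdSymplecticForm 3) := by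
  have hm := mem_formsU_iff.mp (formsUPlus_subset hΩ)
  refine formsUPlus_of_segment hΩ fun t ht0 ht1 => mem_formsU_iff.mpr ⟨?_, fun U hU h0 => ?_⟩
  · rw [smul_smul]
    exact wedgeForms_add_smul hm.1 (wedgeForms_conjForm hm.1) _
  · have hne := hm.2 U hU
    have h1 : Ω (fun j => U j) = -((t : ℂ) * μ * (starRingEnd ℂ) (Ω fun j => U j)) := by
      simp [conjForm_apply] at h0
      linear_combination h0
    have h2 := congrArg norm h1
    rw [norm_neg, norm_mul, norm_mul, RCLike.norm_conj, Complex.norm_real,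
      Real.norm_of_nonneg ht0] at h2
    have h3 : 0 < ‖Ω fun j => U j‖ := norm_pos_iff.mpr hne
    have h4 : t * ‖μ‖ < 1 := by nlinarith [norm_nonneg μ]
    nlinarith

theorem gap_add_smul_conjForm (Ω : (Fin 3 → ℂ) [⋀^Fin 3]→L[ℝ] ℂ) (μ : ℂ) :
    gap (Ω + μ • conjForm Ω) = (1 - ‖μ‖ ^ 2) * gap Ω := by
  simp only [gap, coeffA_add_smul, coeffB_add_smul, coeffA_conjForm, coeffB_conjForm,
    ← Complex.normSq_eq_norm_sq, Complex.normSq_apply]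
  simp
  ring

/-- If `γ₁ + γ₂ + γ₃ ≥ 1`, the polynomial of the diagonal coefficients has a zero on the diagonal of
the polydisc. -/
theorem sum_lt_one_of_formsUPlus {α : ℂ} {γ : Fin 3 → ℝ}
    (h : dolbeaultForm α 0 (α • Matrix.diagonal fun k => (γ k : ℂ)) 0 ∈
      formsUPlus 3 (stdSymplecticForm 3)) : γ 0 + γ 1 + γ 2 < 1 := by
  by_contra! hσ
  set σ := γ 0 + γ 1 + γ 2
  have hσ0 : 0 < σ := by linarith
  -- the common value `w` of the coordinates solves `1 + σ w² = 0`
  refine triaffine_ne_zero_of_formsUPlus h (fun _ => I / (√σ : ℝ)) (fun _ => ?_) ?_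
  · rw [norm_div, Complex.norm_I, Complex.norm_real, Real.norm_of_nonneg (Real.sqrt_nonneg _)]
    exact div_le_one_of_le₀ (Real.one_le_sqrt.mpr hσ) (Real.sqrt_nonneg _)
  · have hw : I / (√σ : ℝ) * (I / (√σ : ℝ)) = -1 / (σ : ℂ) := by
      rw [div_mul_div_comm, Complex.I_mul_I, ← Complex.ofReal_mul, Real.mul_self_sqrt hσ0.le]
    have hσc : (σ : ℂ) ≠ 0 := by exact_mod_cast hσ0.ne'
    have hs : (γ 0 : ℂ) + γ 1 + γ 2 = σ := by simp [σ]
    simp only [triaffine, hw, Matrix.smul_apply, Matrix.diagonal_apply_eq, smul_eq_mul,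
      Matrix.zero_apply, zero_mul, add_zero]
    field_simp
    linear_combination -α * hs

/-- A form in `𝒰⁺(ℂ³)` of type `(3, 0) + (1, 2)` is a multiple of a normal form in the coordinates
provided by the Takagi factorization of its `(1, 2)`-part. -/
theorem exists_unitary_comp_eq_smul_normalForm {a : ℂ} {S : Matrix (Fin 3) (Fin 3) ℂ}
    (hΩ : dolbeaultForm a 0 S 0 ∈ formsUPlus 3 (stdSymplecticForm 3)) (ha : a ≠ 0) :
    ∃ k ∈ symplecticAut (stdSymplecticForm 3), ∃ α : ℂ, ∃ γ : Fin 3 → ℝ, α ≠ 0 ∧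
      0 ≤ γ 0 ∧ Monotone γ ∧ γ 0 + γ 1 + γ 2 < 1 ∧
      (dolbeaultForm a 0 S 0).compContinuousLinearMap
        (k : (Fin 3 → ℂ) →L[ℝ] (Fin 3 → ℂ)) = α • normalForm (γ 0) (γ 1) (γ 2) := by
  have hsymm : S.IsSymm := (coeff_isSymm_of_primitive (formsUPlus_subset hΩ).1).1
  obtain ⟨U₀, hU₀, γ, hγ0, hγm, hγ⟩ := exists_takagi (S := (a)⁻¹ • S)
    (by rw [Matrix.IsSymm, Matrix.transpose_smul, hsymm.eq])
  -- the phase `ζ` is chosen so that `U = ζ U₀` acts in the same way on both components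
  obtain ⟨ζ, hζ⟩ := IsAlgClosed.exists_pow_nat_eq (U₀.det ^ 2)⁻¹ (n := 4) (by norm_num)
  have hd := norm_det_of_unitary hU₀
  have hd0 : U₀.det ≠ 0 := norm_pos_iff.mp (by rw [hd]; exact one_pos)
  have hζ1 : ‖ζ‖ = 1 := by
    have := congrArg norm hζ
    rw [norm_pow, norm_inv, norm_pow, hd, one_pow, inv_one] at this
    exact (pow_eq_one_iff_of_nonneg (norm_nonneg _) four_ne_zero).mp this
  have hU : ζ • U₀ ∈ Matrix.unitaryGroup (Fin 3) ℂ := by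
    rw [Matrix.mem_unitaryGroup_iff', star_smul, Matrix.smul_mul, Matrix.mul_smul, smul_smul,
      Matrix.mem_unitaryGroup_iff'.mp hU₀, RCLike.star_def, ← Complex.normSq_eq_conj_mul_self,
      Complex.normSq_eq_norm_sq, hζ1]
    simp
  have hdet : (ζ • U₀).det = ζ ^ 3 * U₀.det := by
    rw [Matrix.det_smul, Fintype.card_fin]
  have hphase : (starRingEnd ℂ) (ζ • U₀).det * ζ ^ 2 = (ζ • U₀).det := by
    have h1 : (ζ • U₀).det * (starRingEnd ℂ) (ζ • U₀).det = 1 := by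
      rw [Complex.mul_conj, Complex.normSq_eq_norm_sq, norm_det_of_unitary hU]
      simp
    have h2 : ζ ^ 2 = (ζ • U₀).det ^ 2 := by
      rw [hdet, show (ζ ^ 3 * U₀.det) ^ 2 = ζ ^ 2 * (ζ ^ 4 * U₀.det ^ 2) by ring, hζ,
        inv_mul_cancel₀ (pow_ne_zero 2 hd0), mul_one]
    rw [h2]
    linear_combination (ζ • U₀).det * h1
  set α := a * (ζ • U₀).det with hα
  have hα0 : α ≠ 0 := mul_ne_zero ha (norm_pos_iff.mp (by
    rw [norm_det_of_unitary hU]; exact one_pos))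
  have hS₂ : (starRingEnd ℂ) (ζ • U₀).det • ((ζ • U₀)ᵀ * S * (ζ • U₀)) =
      α • Matrix.diagonal fun k => (γ k : ℂ) := by
    have h1 : (ζ • U₀)ᵀ * S * (ζ • U₀) =
        (ζ ^ 2 * a) • (U₀ᵀ * ((a)⁻¹ • S) * U₀) := by
      rw [Matrix.transpose_smul, Matrix.smul_mul, Matrix.smul_mul, Matrix.mul_smul, smul_smul,
        Matrix.mul_smul, Matrix.smul_mul, smul_smul, mul_inv_cancel_right₀ ha, pow_two]
    rw [h1, hγ, smul_smul, ← mul_assoc, hphase, mul_comm _ a]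
  obtain ⟨k, hk, hkU⟩ := exists_symplecticAut (unitaryCLM_symplectic hU)
  have hk₃ : (dolbeaultForm a 0 S 0).compContinuousLinearMap
      (k : (Fin 3 → ℂ) →L[ℝ] (Fin 3 → ℂ)) =
        dolbeaultForm α 0 (α • Matrix.diagonal fun k => (γ k : ℂ)) 0 := by
    rw [hkU, dolbeaultForm_comp_unitaryCLM a S hU, hS₂]
  refine ⟨k, hk, α, γ, hα0, hγ0, hγm, sum_lt_one_of_formsUPlus (α := α) ?_, ?_⟩
  · rw [← hk₃]
    exact formsUPlus_comp hk hΩ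
  · rw [hk₃]
    ext v
    have hdiag : (fun k => (γ k : ℂ)) = ![(γ 0 : ℂ), γ 1, γ 2] := by
      funext k; fin_cases k <;> rfl
    rw [hdiag, normalForm_eq_dolbeaultForm]
    simp [dolbeaultForm, ContinuousAlternatingMap.sum_apply, Finset.mul_sum, mul_assoc]

/-- Every form in `𝒰⁺(ℂ³)` becomes a multiple of a normal form after a symplectic change of
coordinates and a transformation `z ↦ z + μ z̄` of the values. -/
theorem exists_comp_eq_smul_normalForm {Ω : (Fin 3 → ℂ) [⋀^Fin 3]→L[ℝ] ℂ}
    (hΩ : Ω ∈ formsUPlus 3 (stdSymplecticForm 3)) :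
    ∃ g ∈ symplecticAut (stdSymplecticForm 3), ∃ μ α : ℂ, ∃ γ : Fin 3 → ℝ, ‖μ‖ < 1 ∧ α ≠ 0 ∧
      0 ≤ γ 0 ∧ Monotone γ ∧ γ 0 + γ 1 + γ 2 < 1 ∧
      (Ω + μ • conjForm Ω).compContinuousLinearMap (g : (Fin 3 → ℂ) →L[ℝ] (Fin 3 → ℂ)) =
        α • normalForm (γ 0) (γ 1) (γ 2) := by
  obtain ⟨g, hg, hmin⟩ := exists_gap_minimizer hΩ
  set Ω₁ := Ω.compContinuousLinearMap (g : (Fin 3 → ℂ) →L[ℝ] (Fin 3 → ℂ)) with hΩ₁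
  have hΩ₁mem : Ω₁ ∈ formsUPlus 3 (stdSymplecticForm 3) := formsUPlus_comp hg hΩ
  have hdom := norm_coeffB_lt_norm_coeffA hΩ₁mem
  have ha : coeffA Ω₁ ≠ 0 := norm_pos_iff.mp ((norm_nonneg _).trans_lt hdom)
  -- the change of values which removes the `(0, 3)`-part
  set μ : ℂ := -coeffB Ω₁ / (starRingEnd ℂ) (coeffA Ω₁) with hμ
  have hμ1 : ‖μ‖ < 1 := by
    rw [hμ, norm_div, norm_neg, RCLike.norm_conj, div_lt_one (norm_pos_iff.mpr ha)]
    exact hdom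
  set Ω₂ := Ω₁ + μ • conjForm Ω₁ with hΩ₂
  have hΩ₂mem : Ω₂ ∈ formsUPlus 3 (stdSymplecticForm 3) := add_smul_conjForm_mem hΩ₁mem hμ1
  have hb₂ : coeffB Ω₂ = 0 := by
    have : (starRingEnd ℂ) (coeffA Ω₁) ≠ 0 := by simpa using ha
    rw [hΩ₂, coeffB_add_smul, coeffB_conjForm, hμ, div_mul_cancel₀ _ this, add_neg_cancel]
  have ha₂ : coeffA Ω₂ ≠ 0 :=
    norm_pos_iff.mp ((norm_nonneg _).trans_lt (norm_coeffB_lt_norm_coeffA hΩ₂mem))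
  have hw₂ := (formsUPlus_subset hΩ₂mem).1
  have hT : coeffT Ω₂ = 0 := by
    refine coeffT_eq_zero_of_minimal hw₂ hb₂ ha₂ fun u s => ?_
    rw [hΩ₂, add_smul_comp, conjForm_comp, gap_add_smul_conjForm, gap_add_smul_conjForm]
    refine mul_le_mul_of_nonneg_left ?_ (by nlinarith [norm_nonneg μ])
    exact hmin ((g : (Fin 3 → ℂ) →L[ℝ] (Fin 3 → ℂ)).comp (transvection u s)) fun v w =>
      (hg _ _).trans (transvection_symplectic u s v w)
  have hΩ₂eq : Ω₂ = dolbeaultForm (coeffA Ω₂) 0 (coeffS Ω₂) 0 := by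
    conv_lhs => rw [eq_dolbeaultForm Ω₂, hb₂, hT]
  have hΩ₂mem' := hΩ₂mem
  rw [hΩ₂eq] at hΩ₂mem'
  obtain ⟨k, hk, α, γ, hα, hγ0, hγm, hsum, h⟩ :=
    exists_unitary_comp_eq_smul_normalForm hΩ₂mem' ha₂
  rw [← hΩ₂eq] at h
  exact ⟨g * k, mul_mem hg hk, μ, α, γ, hμ1, hα, hγ0, hγm, hsum, h⟩

end NormalForm

/-! ### The group action on the values -/

section Orbit
open Complex Matrix

theorem matrixOnComplex_apply (A : Matrix (Fin 2) (Fin 2) ℝ) (z : ℂ) :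
    matrixOnComplex A z = ⟨A 0 0 * z.re + A 0 1 * z.im, A 1 0 * z.re + A 1 1 * z.im⟩ := by
  rw [matrixOnComplex, LinearMap.coe_toContinuousLinearMap', Matrix.toLin_apply]
  apply Complex.ext <;> simp [Fin.sum_univ_two, Matrix.mulVec, dotProduct]

/-- The matrix of `z ↦ β (z + μ z̄)`. -/
def beltramiMatrix (β μ : ℂ) : Matrix (Fin 2) (Fin 2) ℝ :=
  !![(β * (1 + μ)).re, (β * (I * (1 - μ))).re; (β * (1 + μ)).im, (β * (I * (1 - μ))).im]

theorem matrixOnComplex_beltramiMatrix (β μ z : ℂ) :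
    matrixOnComplex (beltramiMatrix β μ) z = β * (z + μ * (starRingEnd ℂ) z) := by
  rw [matrixOnComplex_apply]
  apply Complex.ext <;> simp [beltramiMatrix] <;> ring

theorem det_beltramiMatrix_pos {β μ : ℂ} (hβ : β ≠ 0) (hμ : ‖μ‖ < 1) :
    0 < (beltramiMatrix β μ).det := by
  have e : (beltramiMatrix β μ).det = Complex.normSq β * (1 - ‖μ‖ ^ 2) := by
    rw [← Complex.normSq_eq_norm_sq, Complex.normSq_apply, Complex.normSq_apply]
    simp [beltramiMatrix, Matrix.det_fin_two]
    ring
  rw [e]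
  have h1 := Complex.normSq_pos.mpr hβ
  have h2 : 0 < 1 - ‖μ‖ ^ 2 := by nlinarith [norm_nonneg μ]
  positivity

theorem mem_orbit_of_comp_eq_smul {Ω Ω' : (Fin 3 → ℂ) [⋀^Fin 3]→L[ℝ] ℂ}
    {g : (Fin 3 → ℂ) ≃L[ℝ] (Fin 3 → ℂ)} (hg : g ∈ symplecticAut (stdSymplecticForm 3)) {μ α : ℂ}
    (hμ : ‖μ‖ < 1) (hα : α ≠ 0)
    (h : (Ω + μ • conjForm Ω).compContinuousLinearMap (g : (Fin 3 → ℂ) →L[ℝ] (Fin 3 → ℂ)) =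
      α • Ω') :
    Ω' ∈ MulAction.orbit (symplecticAut (stdSymplecticForm 3) × Matrix.GLPos (Fin 2) ℝ) Ω := by
  have hdet := det_beltramiMatrix_pos (inv_ne_zero hα) hμ
  refine ⟨(⟨g, hg⟩⁻¹, ⟨Matrix.GeneralLinearGroup.mkOfDetNeZero _ hdet.ne', hdet⟩), ?_⟩
  ext v
  have hv := congrArg (fun F : (Fin 3 → ℂ) [⋀^Fin 3]→L[ℝ] ℂ => F v) h
  change Ω (g ∘ v) + μ * (starRingEnd ℂ) (Ω (g ∘ v)) = α * Ω' v at hv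
  change matrixOnComplex (beltramiMatrix α⁻¹ μ)
    (Ω fun i => ((((⟨g, hg⟩ : symplecticAut (stdSymplecticForm 3))⁻¹)⁻¹ :
      symplecticAut (stdSymplecticForm 3)) : (Fin 3 → ℂ) ≃L[ℝ] (Fin 3 → ℂ)) (v i)) = Ω' v
  rw [inv_inv, matrixOnComplex_beltramiMatrix]
  change α⁻¹ * (Ω (g ∘ v) + μ * (starRingEnd ℂ) (Ω (g ∘ v))) = Ω' v
  rw [hv, inv_mul_cancel_left₀ hα]

end Orbit

end

theorem mainTheorem2 :
    (∀ Ω ∈ formsUPlus 3 (stdSymplecticForm 3), ∃ γ₁ γ₂ γ₃ : ℝ,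
      0 ≤ γ₁ ∧ γ₁ ≤ γ₂ ∧ γ₂ ≤ γ₃ ∧ γ₁ + γ₂ + γ₃ < 1 ∧
      normalForm γ₁ γ₂ γ₃ ∈
        MulAction.orbit (symplecticAut (stdSymplecticForm 3) × Matrix.GLPos (Fin 2) ℝ) Ω) ∧
    (∀ γ₁ γ₂ γ₃ : ℝ, 0 ≤ γ₁ → γ₁ ≤ γ₂ → γ₂ ≤ γ₃ → γ₁ + γ₂ + γ₃ < 1 →
      normalForm γ₁ γ₂ γ₃ ∈ formsUPlus 3 (stdSymplecticForm 3)) := by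
  refine ⟨fun Ω hΩ => ?_, fun γ₁ γ₂ γ₃ h1 h2 h3 h => ?_⟩
  · obtain ⟨g, hg, μ, α, γ, hμ, hα, h0, hm, hs, h⟩ := exists_comp_eq_smul_normalForm hΩ
    exact ⟨γ 0, γ 1, γ 2, h0, hm (by decide), hm (by decide), hs,
      mem_orbit_of_comp_eq_smul hg hμ hα h⟩
  · exact normalForm_mem_formsUPlus h1 (h1.trans h2) ((h1.trans h2).trans h3) h
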